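/- For an integer $s\ge 1$ let $B(s,\lambda)=\frac{\lambda^s/s!}{\sum_{k=0}^s\lambda^k/k!}$ be the Erlang B formula, which is the rejection probability $D_F^R(s,\lambda)$ of the $s$-server system in the loss case $F\equiv 0$ (no customer that finds all servers busy is admitted), and let $$f_s(\delta)=\sqrt s\,\Bigl(1-\frac{\delta}{\sqrt s}\Bigr)B(s,s-\delta\sqrt s),\qquad \delta\le\sqrt s .$$ For every $\gamma\in(0,\sqrt s)$ Cohen's equation $a=f_s(\gamma-a)$ has a unique solution $a=a_s(\gamma)\ge 0$. Put $$L_s(\gamma)=\frac{(\sqrt s-\gamma)^2}{\sqrt s-\gamma+a_s(\gamma)},\qquad 0<\gamma<\sqrt s .$$ Then, for every integer $s\ge1$ and with implied constants that do not depend on $s$, $$L_s(\gamma)\in(0,\sqrt s-\gamma)\quad(0<\gamma<\sqrt s),$$ $$L_s(\gamma)=\gamma s\,\bigl(1+O(\gamma\sqrt s)\bigr)\quad(\gamma\downarrow0),$$ $$L_s(\gamma)=(\sqrt s-\gamma)\Bigl(1+O\Bigl(\frac{e^s}{\sqrt s}\Bigl(1-\frac{\gamma}{\sqrt s}\Bigr)^s\Bigr)\Bigr)\quad(\gamma\uparrow\sqrt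 s).$$ The equation $\gamma\,a_s(\gamma)=\frac12\bigl(1-\frac{\gamma}{\sqrt s}\bigr)$ has a unique solution $\gamma=\hat\gamma_s$ in $(0,\sqrt s)$. The function $L_s$ is unimodal: it is strictly increasing on $(0,\hat\gamma_s]$ and strictly decreasing on $[\hat\gamma_s,\sqrt s)$, so that its maximum on $(0,\sqrt s)$ is attained exactly at $\hat\gamma_s$; the maximum value is $$L_s(\hat\gamma_s)=\frac{\hat\gamma_s}{\hat\gamma_s+\frac1{2\sqrt s}}\,(\sqrt s-\hat\gamma_s).$$ Moreover, for $s\ge2$, $$\hat\gamma_s>f_s(0)>\Bigl(\frac12+\frac1{16s}\Bigr)^{1/2}-\frac1{4\sqrt s}.$$ Finally, $\hat\gamma_s$ is strictly increasing in $s\ge1$, with $\hat\gamma_1=\frac12$, $|\hat\gamma_{550}-1|<10^{-3}$, and $\hat\gamma_s\to\hat\gamma_\infty$ as $s\to\infty$, where $1.0341134595<\hat\gamma_\infty<1.0341134596$. -/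

import Mathlib

open Set Filter Topology

noncomputable section

/-- The Erlang B formula: blocking probability of the `M/M/s/s` system with offered load `lam`. -/
def erlangB (s : ℕ) (lam : ℝ) : ℝ :=
  (lam ^ s / (s.factorial : ℝ)) /
    ∑ k ∈ Finset.range (s + 1), lam ^ k / (k.factorial : ℝ)

/-- The stationary rejection probability `D_F^R(s, lam)` of the `s`-server system whose admission
policy `(p_k)_{k ≥ s}` has the generating function `F(x) = ∑ₙ p_s ⋯ p_{s+n} x^(n+1)`. -/
def rejectionProb (s : ℕ) (F : ℝ → ℝ) (lam : ℝ) : ℝ :=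
  (1 + (1 - s / lam) * F (lam / s)) / ((erlangB s lam)⁻¹ + F (lam / s))

/-- `f_{s,F}^R(δ) = √s (1 - δ/√s) D_F^R(s, s - δ√s)`. -/
def scaledRejection (s : ℕ) (F : ℝ → ℝ) (δ : ℝ) : ℝ :=
  √s * (1 - δ / √s) * rejectionProb s F (s - δ * √s)

/-- The function `f_s` of the loss system, in which `p_k = 0` for all `k ≥ s`, so `F ≡ 0`. -/
def lossF (s : ℕ) (δ : ℝ) : ℝ := scaledRejection s (fun _ => 0) δ

theorem lossF_eq (s : ℕ) (δ : ℝ) :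
    lossF s δ = √s * (1 - δ / √s) * erlangB s (s - δ * √s) := by
  simp [lossF, scaledRejection, rejectionProb]

/-- `a` solves Cohen's equation `a = f_s(γ - a)`. Here `a√s` is the rate of reattempts, so it is
nonnegative; for `γ < √s` this also keeps `γ - a` in the domain `(-∞, √s]` of `f_s`. -/
def IsCohenSolution (s : ℕ) (γ a : ℝ) : Prop := 0 ≤ a ∧ a = lossF s (γ - a)

/-- `a_s(γ)`, the solution of Cohen's equation. -/
def cohenSol (s : ℕ) (γ : ℝ) : ℝ := Classical.epsilon (IsCohenSolution s γ)

/-- `L_s(γ) = (√s - γ)² / (√s - γ + a_s(γ))`. -/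
def carriedL (s : ℕ) (γ : ℝ) : ℝ := (√s - γ) ^ 2 / (√s - γ + cohenSol s γ)

end

/-! Everything becomes explicit when `γ` is parametrized by the total load `λ`, including
reattempts. With the carried load `C(λ) = λ(1 - B(s,λ))`, a strictly increasing bijection of `(0,∞)`
onto `(0,s)`, put `γ = (s - C)/√s` (`slack`). Then `a_s(γ) = (λ - C)/√s` and `L_s = C²/(λ√s)`. The
derivative of `C²/λ` has the sign of `-(2(s - C)(λ - C) - C)`, and the vanishing of this
`overloadGap` is exactly the equation for `γ̂_s`. The gap changes sign upwards at each zero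
(`overloadGap_upcrossing`), so there is one zero, which gives unimodality.

Comparing different `s` requires a continuous parameter. With `ε = 1/√s`, the scaled loss `f_s(δ)`
is `1/V(ε,δ)`, where `V` is the integral over `y > 0` of `exp(δy - y/ε + log(1 + εy)/ε²)`
(`inv_tiltMoment_eq`). This makes sense for all `ε > 0` and becomes Gaussian at `ε = 0`. With `a =
1/V` and `γ = δ + a`, the optimality condition reads `(δ + a)(ε + 2a) = 1`, that is `cohenGap ε δ =
0`.

Along suitable lines `δ = δ₀ + dε` the gap increases through each of its zeros. This rests on a
lower bound for the growth of `V` that involves three moments only; integration by parts makes these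
moments rational in `ε`, `δ`, `a`, so polynomial inequalities remain (`half_lt_mul_growthRate`,
`lt_mul_growthRate`). The line `d = 0`, started from the explicit case `ε = 1`, shows that the
optimal load is at most `s` and gives the lower bounds on `γ̂_s`. The line `d = 1/2` holds `γ` fixed
in the root equation and gives monotonicity in `s`. The limit solves `V(0, γ - 1/(2γ)) = 2γ` and is
located numerically. -/

/-! ### The tilted weights and their moments. -/

/-- `∫₀^y u / (1 + |ε u|) du`; for `ε > 0` and `y ≥ 0` it is `y/ε - log (1 + ε y)/ε²`. -/
noncomputable def tiltExponent (ε y : ℝ) : ℝ := ∫ u in (0 : ℝ)..y, u / (1 + |ε * u|)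

/-- The weight `exp (δ y - tiltExponent ε y)`. -/
noncomputable def tiltWeight (ε δ y : ℝ) : ℝ := Real.exp (δ * y - tiltExponent ε y)

/-- The moments of `tiltWeight ε δ` on the half line. -/
noncomputable def tiltMoment (n : ℕ) (ε δ : ℝ) : ℝ :=
  ∫ y in Ioi (0 : ℝ), y ^ n * tiltWeight ε δ y

/-- The absolute value keeps the denominator at least `1`, so continuity is joint and global,
including `ε = 0`. -/
theorem continuous_tiltIntegrand : Continuous fun p : ℝ × ℝ => p.2 / (1 + |p.1 * p.2|) := by
  refine Continuous.div (by fun_prop) (by fun_prop) fun p => ?_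
  positivity

theorem continuous_tiltExponent : Continuous fun p : ℝ × ℝ => tiltExponent p.1 p.2 :=
  intervalIntegral.continuous_parametric_primitive_of_continuous
    (f := fun ε u : ℝ => u / (1 + |ε * u|)) (a₀ := 0) continuous_tiltIntegrand

theorem continuous_tiltWeight_right (ε δ : ℝ) : Continuous (tiltWeight ε δ) := by
  have : Continuous fun y => tiltExponent ε y :=
    continuous_tiltExponent.comp (by fun_prop : Continuous fun y : ℝ => (ε, y))
  unfold tiltWeight
  fun_prop

theorem tiltWeight_pos (ε δ y : ℝ) : 0 < tiltWeight ε δ y := Real.exp_pos _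

@[simp] theorem tiltExponent_zero_right (ε : ℝ) : tiltExponent ε 0 = 0 := by
  simp [tiltExponent]

@[simp] theorem tiltWeight_zero_right (ε δ : ℝ) : tiltWeight ε δ 0 = 1 := by
  simp [tiltWeight]

theorem hasDerivAt_tiltExponent {ε y : ℝ} (hε : 0 ≤ ε) (hy : 0 ≤ y) :
    HasDerivAt (tiltExponent ε) (y / (1 + ε * y)) y := by
  have hc : Continuous fun u : ℝ => u / (1 + |ε * u|) :=
    continuous_tiltIntegrand.comp (by fun_prop : Continuous fun y : ℝ => (ε, y))
  have h := intervalIntegral.integral_hasDerivAt_right (hc.intervalIntegrable 0 y)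
    (hc.stronglyMeasurableAtFilter _ _) hc.continuousAt
  rwa [abs_of_nonneg (by positivity)] at h

theorem hasDerivAt_tiltWeight {ε y : ℝ} (δ : ℝ) (hε : 0 ≤ ε) (hy : 0 ≤ y) :
    HasDerivAt (tiltWeight ε δ) (tiltWeight ε δ y * (δ - y / (1 + ε * y))) y := by
  have h := (((hasDerivAt_id y).const_mul δ).sub (hasDerivAt_tiltExponent hε hy)).exp
  rw [mul_one] at h
  exact h

/-- A function with nonnegative derivative on a half line is at least its initial value. -/
theorem le_of_hasDerivAt_nonneg {f f' : ℝ → ℝ} {a y : ℝ}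
    (hf : ∀ x, a ≤ x → HasDerivAt f (f' x) x) (hf' : ∀ x, a ≤ x → 0 ≤ f' x) (hy : a ≤ y) :
    f a ≤ f y := by
  refine monotoneOn_of_deriv_nonneg (convex_Ici a)
    (fun x hx => (hf x hx).continuousAt.continuousWithinAt) (fun x hx => ?_) (fun x hx => ?_)
    (mem_Ici.2 le_rfl) (mem_Ici.2 hy) hy
  · rw [interior_Ici] at hx
    exact (hf x hx.le).differentiableAt.differentiableWithinAt
  · rw [interior_Ici] at hx
    rw [(hf x hx.le).deriv]
    exact hf' x hx.le

theorem tiltExponent_nonneg {ε y : ℝ} (hε : 0 ≤ ε) (hy : 0 ≤ y) : 0 ≤ tiltExponent ε y := by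
  have := le_of_hasDerivAt_nonneg (fun x hx => hasDerivAt_tiltExponent hε hx)
    (fun x (hx : 0 ≤ x) => by positivity) hy
  simpa using this

/-- Tangent-type lower bound for the difference of two exponents. -/
theorem tiltExponent_sub_ge {ε₁ ε₂ y : ℝ} (c : ℝ) (h₁ : 0 ≤ ε₁) (h₁₂ : ε₁ ≤ ε₂) (hy : 0 ≤ y) :
    (ε₂ - ε₁) * (c * y ^ 2 - c ^ 2 * (y + (ε₁ + ε₂) / 2 * y ^ 2 + ε₁ * ε₂ / 3 * y ^ 3)) ≤
      tiltExponent ε₁ y - tiltExponent ε₂ y := by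
  have h₂ : 0 ≤ ε₂ := h₁.trans h₁₂
  have key := le_of_hasDerivAt_nonneg (a := 0) (y := y)
    (f := fun y => tiltExponent ε₁ y - tiltExponent ε₂ y -
      (ε₂ - ε₁) * (c * y ^ 2 - c ^ 2 * (y + (ε₁ + ε₂) / 2 * y ^ 2 + ε₁ * ε₂ / 3 * y ^ 3)))
    (f' := fun y => y / (1 + ε₁ * y) - y / (1 + ε₂ * y) -
      (ε₂ - ε₁) * (c * (2 * y) - c ^ 2 * (1 + (ε₁ + ε₂) / 2 * (2 * y) + ε₁ * ε₂ / 3 * (3 * y ^ 2))))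
    (fun x hx => by
      refine ((hasDerivAt_tiltExponent h₁ hx).sub (hasDerivAt_tiltExponent h₂ hx)).sub ?_
      have e1 := hasDerivAt_id x
      have e2 : HasDerivAt (fun x : ℝ => x ^ 2) (2 * x) x := by simpa using hasDerivAt_pow 2 x
      have e3 : HasDerivAt (fun x : ℝ => x ^ 3) (3 * x ^ 2) x := by simpa using hasDerivAt_pow 3 x
      exact (((e2.const_mul c).sub (((e1.add (e2.const_mul _)).add
        (e3.const_mul _)).const_mul _)).const_mul _))
    (fun x hx => by
      have p₁ : 0 < 1 + ε₁ * x := by positivity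
      have p₂ : 0 < 1 + ε₂ * x := by positivity
      -- With `q = (1 + ε₁x)(1 + ε₂x)` the difference of slopes is `(ε₂ - ε₁)x²/q`, and `x²/q ≥ 2cx
      -- - c²q` for every `c`. The parameter `c` stays free and is optimized later.
      have : x / (1 + ε₁ * x) - x / (1 + ε₂ * x) -
          (ε₂ - ε₁) * (c * (2 * x) -
            c ^ 2 * (1 + (ε₁ + ε₂) / 2 * (2 * x) + ε₁ * ε₂ / 3 * (3 * x ^ 2))) =
          (ε₂ - ε₁) * ((x - c * ((1 + ε₁ * x) * (1 + ε₂ * x))) ^ 2 /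
            ((1 + ε₁ * x) * (1 + ε₂ * x))) := by
        field_simp
        ring
      rw [this]
      have := sub_nonneg.2 h₁₂
      positivity) hy
  simp at key
  linarith

theorem tiltExponent_anti {ε₁ ε₂ y : ℝ} (h₁ : 0 ≤ ε₁) (h₁₂ : ε₁ ≤ ε₂) (hy : 0 ≤ y) :
    tiltExponent ε₂ y ≤ tiltExponent ε₁ y := by
  have := tiltExponent_sub_ge 0 h₁ h₁₂ hy
  simp at this
  exact this

theorem exists_linear_bound {ε δ : ℝ} (hε : 0 ≤ ε) (h : δ * ε < 1) :
    ∃ κ > 0, ∃ C, ∀ y, 0 ≤ y → δ * y - tiltExponent ε y ≤ C - κ * y := by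
  have hk : 0 < 1 - δ * ε := by linarith
  -- The slope `y/(1 + εy)` of the exponent increases, and at `y₀` it already exceeds `δ`; the
  -- excess is the decay rate `κ`.
  set y₀ := (|δ| + 1) / (1 - δ * ε) with hy₀
  have hy₀p : 0 < y₀ := by positivity
  have hq : 0 < 1 + ε * y₀ := by positivity
  have hr : δ < y₀ / (1 + ε * y₀) := by
    rw [lt_div_iff₀ hq]
    have : y₀ * (1 - δ * ε) = |δ| + 1 := by rw [hy₀]; field_simp
    nlinarith [le_abs_self δ]
  refine ⟨y₀ / (1 + ε * y₀) - δ, by linarith, y₀ / (1 + ε * y₀) * y₀, fun y hy => ?_⟩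
  have key : y₀ / (1 + ε * y₀) * (y - y₀) ≤ tiltExponent ε y := by
    rcases le_total y y₀ with hle | hle
    · have := tiltExponent_nonneg hε hy
      have h2 : y₀ / (1 + ε * y₀) * (y - y₀) ≤ 0 :=
        mul_nonpos_of_nonneg_of_nonpos (by positivity) (by linarith)
      linarith
    · have h0 := tiltExponent_nonneg hε hy₀p.le
      have := le_of_hasDerivAt_nonneg (a := y₀) (y := y)
        (f := fun y => tiltExponent ε y - y₀ / (1 + ε * y₀) * y)
        (f' := fun y => y / (1 + ε * y) - y₀ / (1 + ε * y₀))
        (fun x hx => by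
          have := (hasDerivAt_tiltExponent hε (hy₀p.le.trans hx)).sub
            ((hasDerivAt_id x).const_mul (y₀ / (1 + ε * y₀)))
          rw [mul_one] at this
          exact this)
        (fun x hx => by
          have : 0 < 1 + ε * x := by have := hy₀p.le.trans hx; positivity
          rw [sub_nonneg, div_le_div_iff₀ hq this]
          nlinarith) hle
      linarith
  linarith

theorem integrableOn_pow_mul_exp_neg_mul (n : ℕ) {κ : ℝ} (hκ : 0 < κ) :
    MeasureTheory.IntegrableOn (fun y : ℝ => y ^ n * Real.exp (-κ * y)) (Ioi 0) := by
  have := integrableOn_rpow_mul_exp_neg_mul_rpow (s := n) (p := 1) (b := κ)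
    (by have : (0 : ℝ) ≤ n := n.cast_nonneg
        linarith) one_pos hκ
  simpa using this

theorem integrableOn_tiltWeight (n : ℕ) {ε δ : ℝ} (hε : 0 ≤ ε) (h : δ * ε < 1) :
    MeasureTheory.IntegrableOn (fun y : ℝ => y ^ n * tiltWeight ε δ y) (Ioi 0) := by
  obtain ⟨κ, hκ, C, hC⟩ := exists_linear_bound hε h
  refine MeasureTheory.Integrable.mono'
    ((integrableOn_pow_mul_exp_neg_mul n hκ).const_mul (Real.exp C)) ?_ ?_
  · exact ((continuous_pow n).mul (continuous_tiltWeight_right ε δ)).aestronglyMeasurable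
  · filter_upwards [MeasureTheory.ae_restrict_mem measurableSet_Ioi] with y hy
    have hy : 0 < y := hy
    have hw := tiltWeight_pos ε δ y
    rw [Real.norm_of_nonneg (by positivity)]
    calc y ^ n * tiltWeight ε δ y ≤ y ^ n * Real.exp (C - κ * y) := by
          gcongr
          exact Real.exp_le_exp.2 (hC y hy.le)
      _ = Real.exp C * (y ^ n * Real.exp (-κ * y)) := by
          rw [sub_eq_add_neg, Real.exp_add, neg_mul]; ring

theorem tendsto_pow_mul_tiltWeight (n : ℕ) {ε δ : ℝ} (hε : 0 ≤ ε) (h : δ * ε < 1) :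
    Tendsto (fun y : ℝ => y ^ n * tiltWeight ε δ y) atTop (𝓝 0) := by
  obtain ⟨κ, hκ, C, hC⟩ := exists_linear_bound hε h
  have h1 : Tendsto (fun y : ℝ => (κ * y) ^ n * Real.exp (-(κ * y))) atTop (𝓝 0) :=
    (Real.tendsto_pow_mul_exp_neg_atTop_nhds_zero n).comp (tendsto_id.const_mul_atTop hκ)
  have h2 := h1.const_mul (Real.exp C / κ ^ n)
  rw [mul_zero] at h2
  refine squeeze_zero' ?_ ?_ h2
  · filter_upwards [eventually_ge_atTop 0] with y hy
    have hw := tiltWeight_pos ε δ y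
    positivity
  · filter_upwards [eventually_ge_atTop 0] with y hy
    calc y ^ n * tiltWeight ε δ y ≤ y ^ n * Real.exp (C - κ * y) := by
          gcongr
          exact Real.exp_le_exp.2 (hC y hy)
      _ = Real.exp C / κ ^ n * ((κ * y) ^ n * Real.exp (-(κ * y))) := by
          rw [sub_eq_add_neg, Real.exp_add, mul_pow]
          field_simp

theorem tiltMoment_pos (n : ℕ) {ε δ : ℝ} (hε : 0 ≤ ε) (h : δ * ε < 1) :
    0 < tiltMoment n ε δ := by
  have hp : ∀ y ∈ Ioi (0 : ℝ), 0 < y ^ n * tiltWeight ε δ y := fun y hy =>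
    mul_pos (pow_pos hy n) (tiltWeight_pos ε δ y)
  refine (MeasureTheory.setIntegral_pos_iff_support_of_nonneg_ae ?_
    (integrableOn_tiltWeight n hε h)).2 ?_
  · filter_upwards [MeasureTheory.ae_restrict_mem measurableSet_Ioi] with y hy
    exact (hp y hy).le
  · have hsub : Ioi (0 : ℝ) ⊆ Function.support fun y => y ^ n * tiltWeight ε δ y :=
      fun y hy => (hp y hy).ne'
    rw [inter_eq_self_of_subset_right hsub]
    simp

theorem integrableOn_cubic_mul_tiltWeight (a₀ a₁ a₂ a₃ : ℝ) (n : ℕ) {ε δ : ℝ} (hε : 0 ≤ ε)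
    (h : δ * ε < 1) :
    MeasureTheory.IntegrableOn
      (fun y : ℝ => a₀ * (y ^ n * tiltWeight ε δ y) + a₁ * (y ^ (n + 1) * tiltWeight ε δ y) +
        a₂ * (y ^ (n + 2) * tiltWeight ε δ y) + a₃ * (y ^ (n + 3) * tiltWeight ε δ y)) (Ioi 0) :=
  have hi := fun m => integrableOn_tiltWeight m hε h
  ((((hi n).const_mul a₀).add ((hi (n + 1)).const_mul a₁)).add ((hi (n + 2)).const_mul a₂)).add
    ((hi (n + 3)).const_mul a₃)

theorem integral_cubic_mul_tiltWeight (a₀ a₁ a₂ a₃ : ℝ) (n : ℕ) {ε δ : ℝ} (hε : 0 ≤ ε)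
    (h : δ * ε < 1) :
    ∫ y in Ioi (0 : ℝ), (a₀ * (y ^ n * tiltWeight ε δ y) + a₁ * (y ^ (n + 1) * tiltWeight ε δ y) +
        a₂ * (y ^ (n + 2) * tiltWeight ε δ y) + a₃ * (y ^ (n + 3) * tiltWeight ε δ y)) =
      a₀ * tiltMoment n ε δ + a₁ * tiltMoment (n + 1) ε δ + a₂ * tiltMoment (n + 2) ε δ +
        a₃ * tiltMoment (n + 3) ε δ := by
  have hi := fun m => integrableOn_tiltWeight m hε h
  have h1 : MeasureTheory.IntegrableOn (fun y : ℝ => a₀ * (y ^ n * tiltWeight ε δ y) +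
      a₁ * (y ^ (n + 1) * tiltWeight ε δ y)) (Ioi 0) :=
    ((hi n).const_mul a₀).add ((hi (n + 1)).const_mul a₁)
  have h2 := h1.add ((hi (n + 2)).const_mul a₂)
  unfold tiltMoment
  rw [← MeasureTheory.integral_const_mul, ← MeasureTheory.integral_const_mul,
    ← MeasureTheory.integral_const_mul, ← MeasureTheory.integral_const_mul,
    ← MeasureTheory.integral_add ((hi n).const_mul a₀) ((hi (n + 1)).const_mul a₁),
    ← MeasureTheory.integral_add h1 ((hi (n + 2)).const_mul a₂)]
  exact MeasureTheory.integral_add h2 ((hi (n + 3)).const_mul a₃)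

/-- Integrate the derivative of `y^(n+1) (1 + εy) w(y)`: the factor `1 + εy` cancels the denominator
in `w'/w`, so only moments remain. -/
theorem tiltMoment_succ (n : ℕ) {ε δ : ℝ} (hε : 0 ≤ ε) (h : δ * ε < 1) :
    (1 - δ * ε) * tiltMoment (n + 2) ε δ =
      (δ + ε * (n + 2)) * tiltMoment (n + 1) ε δ + (n + 1) * tiltMoment n ε δ := by
  have hlim := (tendsto_pow_mul_tiltWeight (n + 1) hε h).add
    ((tendsto_pow_mul_tiltWeight (n + 2) hε h).const_mul ε)
  rw [mul_zero, add_zero] at hlim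
  have key := MeasureTheory.integral_Ioi_of_hasDerivAt_of_tendsto' (a := 0) (m := 0)
    (f := fun y : ℝ => y ^ (n + 1) * tiltWeight ε δ y + ε * (y ^ (n + 2) * tiltWeight ε δ y))
    (fun y hy => by
      have hy : 0 ≤ y := hy
      have hq : 1 + ε * y ≠ 0 := by positivity
      have hw := hasDerivAt_tiltWeight δ hε hy
      have := ((hasDerivAt_pow (n + 1) y).mul hw).add
        (((hasDerivAt_pow (n + 2) y).mul hw).const_mul ε)
      refine this.congr_deriv ?_
      push_cast
      field_simp
      ring)
    (integrableOn_cubic_mul_tiltWeight (n + 1) (δ + ε * (n + 2)) (-(1 - δ * ε)) 0 n hε h) hlim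
  rw [integral_cubic_mul_tiltWeight _ _ _ _ _ hε h] at key
  norm_num at key
  linarith

theorem tiltMoment_one {ε δ : ℝ} (hε : 0 ≤ ε) (h : δ * ε < 1) :
    (1 - δ * ε) * tiltMoment 1 ε δ = 1 + (δ + ε) * tiltMoment 0 ε δ := by
  have hlim := (tendsto_pow_mul_tiltWeight 0 hε h).add
    ((tendsto_pow_mul_tiltWeight 1 hε h).const_mul ε)
  rw [mul_zero, add_zero] at hlim
  have key := MeasureTheory.integral_Ioi_of_hasDerivAt_of_tendsto' (a := 0) (m := 0)
    (f := fun y : ℝ => y ^ 0 * tiltWeight ε δ y + ε * (y ^ 1 * tiltWeight ε δ y))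
    (fun y hy => by
      have hy : 0 ≤ y := hy
      have hq : 1 + ε * y ≠ 0 := by positivity
      have hw := hasDerivAt_tiltWeight δ hε hy
      have := ((hasDerivAt_pow 0 y).mul hw).add
        (((hasDerivAt_pow 1 y).mul hw).const_mul ε)
      refine this.congr_deriv ?_
      push_cast
      field_simp
      ring)
    (integrableOn_cubic_mul_tiltWeight (δ + ε) (-(1 - δ * ε)) 0 0 0 hε h) hlim
  rw [integral_cubic_mul_tiltWeight _ _ _ _ _ hε h] at key
  norm_num at key ⊢
  linarith

/-- The ratio of the two weights is an exponential; `exp x ≥ 1 + x` and `tiltExponent_sub_ge` bound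
it below by a cubic polynomial in `y`. -/
theorem tiltMoment_zero_growth {ε₁ ε₂ δ₁ δ₂ : ℝ} (c : ℝ) (h₁ : 0 ≤ ε₁) (h₁₂ : ε₁ ≤ ε₂)
    (hd₁ : δ₁ * ε₁ < 1) (hd₂ : δ₂ * ε₂ < 1) :
    tiltMoment 0 ε₁ δ₁ + (δ₂ - δ₁) * tiltMoment 1 ε₁ δ₁ +
      (ε₂ - ε₁) * (c * tiltMoment 2 ε₁ δ₁ - c ^ 2 * (tiltMoment 1 ε₁ δ₁ +
        (ε₁ + ε₂) / 2 * tiltMoment 2 ε₁ δ₁ + ε₁ * ε₂ / 3 * tiltMoment 3 ε₁ δ₁)) ≤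
      tiltMoment 0 ε₂ δ₂ := by
  have hle := MeasureTheory.setIntegral_mono_on
    (integrableOn_cubic_mul_tiltWeight 1 (δ₂ - δ₁ - (ε₂ - ε₁) * c ^ 2)
      ((ε₂ - ε₁) * (c - c ^ 2 * ((ε₁ + ε₂) / 2))) (-((ε₂ - ε₁) * c ^ 2 * (ε₁ * ε₂ / 3))) 0 h₁ hd₁)
    (integrableOn_tiltWeight 0 (h₁.trans h₁₂) hd₂) measurableSet_Ioi (fun y hy => by
      have hy : 0 < y := hy
      have hb := tiltExponent_sub_ge c h₁ h₁₂ hy.le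
      have hexp := Real.add_one_le_exp
        ((δ₂ - δ₁) * y + (tiltExponent ε₁ y - tiltExponent ε₂ y))
      have hw : tiltWeight ε₂ δ₂ y = tiltWeight ε₁ δ₁ y *
          Real.exp ((δ₂ - δ₁) * y + (tiltExponent ε₁ y - tiltExponent ε₂ y)) := by
        simp only [tiltWeight]
        rw [← Real.exp_add]
        ring_nf
      have hwp := tiltWeight_pos ε₁ δ₁ y
      simp only [hw, pow_zero, one_mul]
      have hm := mul_le_mul_of_nonneg_left
        ((add_le_add_left (add_le_add_right hb ((δ₂ - δ₁) * y)) 1).trans hexp) hwp.le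
      refine le_trans (le_of_eq ?_) hm
      ring)
  rw [integral_cubic_mul_tiltWeight _ _ _ _ _ h₁ hd₁] at hle
  refine le_trans (le_of_eq ?_) hle
  ring_nf

/-- The weight increases in both `ε` and `δ`, so its value at a slightly larger pair dominates.
Allowing `ε = 0` covers the limit `s → ∞`. -/
theorem tendsto_tiltMoment_zero {ι : Type*} {l : Filter ι} [l.IsCountablyGenerated]
    {e d : ι → ℝ} {ε δ : ℝ} (hε : 0 ≤ ε) (h : δ * ε < 1) (he : Tendsto e l (𝓝 ε))
    (hd : Tendsto d l (𝓝 δ)) (hpos : ∀ᶠ t in l, 0 ≤ e t) :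
    Tendsto (fun t => tiltMoment 0 (e t) (d t)) l (𝓝 (tiltMoment 0 ε δ)) := by
  obtain ⟨η, hη, hη1⟩ : ∃ η > 0, (δ + η) * (ε + η) < 1 := by
    have hc : ContinuousAt (fun η : ℝ => (δ + η) * (ε + η)) 0 := by fun_prop
    have := (hc.eventually (gt_mem_nhds (by simpa using h : (δ + 0) * (ε + 0) < 1)))
    have := (this.filter_mono nhdsWithin_le_nhds).and
      (self_mem_nhdsWithin : ∀ᶠ x in 𝓝[>] (0 : ℝ), x ∈ Ioi (0 : ℝ))
    obtain ⟨η, h1, h2⟩ := this.exists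
    exact ⟨η, h2, h1⟩
  unfold tiltMoment
  refine MeasureTheory.tendsto_integral_filter_of_dominated_convergence
    (fun y => y ^ 0 * tiltWeight (ε + η) (δ + η) y) ?_ ?_
    (integrableOn_tiltWeight 0 (by linarith) hη1) ?_
  · exact .of_forall fun t =>
      ((continuous_pow 0).mul (continuous_tiltWeight_right _ _)).aestronglyMeasurable
  · filter_upwards [hpos, he.eventually (gt_mem_nhds (by linarith : ε < ε + η)),
      hd.eventually (gt_mem_nhds (by linarith : δ < δ + η))] with t h0 h1 h2
    filter_upwards [MeasureTheory.ae_restrict_mem measurableSet_Ioi] with y hy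
    have hy : 0 < y := hy
    have hw := tiltWeight_pos (e t) (d t) y
    rw [Real.norm_of_nonneg (by positivity)]
    refine mul_le_mul_of_nonneg_left (Real.exp_le_exp.2 ?_) (by positivity)
    have := tiltExponent_anti h0 h1.le hy.le
    have : d t * y ≤ (δ + η) * y := by gcongr
    linarith
  · refine .of_forall fun y => ?_
    have hR : Tendsto (fun t => tiltExponent (e t) y) l (𝓝 (tiltExponent ε y)) := by
      have hc : ContinuousAt (fun x : ℝ => tiltExponent x y) ε :=
        (continuous_tiltExponent.comp (by fun_prop : Continuous fun x : ℝ => (x, y))).continuousAt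
      exact hc.tendsto.comp he
    exact (((hd.mul_const y).sub hR).rexp).const_mul _

/-! ### Upcrossings. -/

/-- If a continuous function changes sign from negative to positive at each of its zeros and is
nonpositive at the right end point, then it is negative before. -/
theorem neg_of_upcrossing {F : ℝ → ℝ} {x₀ x₁ : ℝ} (hF : ContinuousOn F (Icc x₀ x₁))
    (hz : ∀ z ∈ Icc x₀ x₁, F z = 0 → ∀ᶠ x in 𝓝 z, (x < z → F x < 0) ∧ (z < x → 0 < F x))
    (h₁ : F x₁ ≤ 0) : ∀ x ∈ Ico x₀ x₁, F x < 0 := by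
  have hpos : ∀ x ∈ Ico x₀ x₁, ¬ 0 < F x := by
    intro x hx hFx
    have hsub : Icc x x₁ ⊆ Icc x₀ x₁ := Icc_subset_Icc_left hx.1
    have hcl : IsClosed (Icc x x₁ ∩ F ⁻¹' Iic 0) :=
      (hF.mono hsub).preimage_isClosed_of_isClosed isClosed_Icc isClosed_Iic
    have hbdd : BddBelow (Icc x x₁ ∩ F ⁻¹' Iic 0) := ⟨x, fun t ht => ht.1.1⟩
    have hmem := hcl.csInf_mem ⟨x₁, ⟨hx.2.le, le_rfl⟩, h₁⟩ hbdd
    -- The first point after `x` with `F ≤ 0` is a zero, yet an upcrossing there would make `F`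
    -- negative just before it.
    set z := sInf (Icc x x₁ ∩ F ⁻¹' Iic 0) with hzdef
    obtain ⟨t, ht, hFt⟩ : (0 : ℝ) ∈ F '' Icc x z :=
      intermediate_value_Icc' hmem.1.1 (hF.mono ((Icc_subset_Icc_right hmem.1.2).trans hsub))
        ⟨hmem.2, hFx.le⟩
    have htz : z ≤ t := csInf_le hbdd ⟨⟨ht.1, ht.2.trans hmem.1.2⟩, hFt.le⟩
    have hFz : F z = 0 := by rw [le_antisymm htz ht.2, hFt]
    have hxz : x < z := lt_of_le_of_ne hmem.1.1 (by rintro h; rw [← h] at hFz; linarith)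
    have hev := ((hz z (hsub hmem.1) hFz).filter_mono nhdsWithin_le_nhds).and
      (Ioo_mem_nhdsLT hxz)
    obtain ⟨u, hu, hu'⟩ := hev.exists
    have : z ≤ u := csInf_le hbdd ⟨⟨hu'.1.le, hu'.2.le.trans hmem.1.2⟩, (hu.1 hu'.2).le⟩
    linarith [hu'.2]
  intro x hx
  rcases lt_trichotomy (F x) 0 with h | h | h
  · exact h
  · have hev := ((hz x ⟨hx.1, hx.2.le⟩ h).filter_mono nhdsWithin_le_nhds).and
      (Ioo_mem_nhdsGT hx.2)
    obtain ⟨u, hu, hu'⟩ := hev.exists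
    exact absurd (hu.2 hu'.1) (hpos u ⟨hx.1.trans hu'.1.le, hu'.2⟩)
  · exact absurd h (hpos x hx)

/-! ### Growth of the mass and upcrossings of the gap. -/

/-- The mean of the normalized weight when `a` is the reciprocal of its mass. -/
noncomputable def normMoment₁ (ε δ a : ℝ) : ℝ := (δ + ε + a) / (1 - δ * ε)

/-- The second moment of the normalized weight. -/
noncomputable def normMoment₂ (ε δ a : ℝ) : ℝ :=
  ((δ + 2 * ε) * normMoment₁ ε δ a + 1) / (1 - δ * ε)

/-- The third moment of the normalized weight. -/
noncomputable def normMoment₃ (ε δ a : ℝ) : ℝ :=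
  ((δ + 3 * ε) * normMoment₂ ε δ a + 2 * normMoment₁ ε δ a) / (1 - δ * ε)

/-- A lower bound for the relative growth of the mass when `δ` moves with speed `d`. -/
noncomputable def growthRate (c d ε ε' δ a : ℝ) : ℝ :=
  d * normMoment₁ ε δ a + (c * normMoment₂ ε δ a - c ^ 2 * (normMoment₁ ε δ a +
    (ε + ε') / 2 * normMoment₂ ε δ a + ε * ε' / 3 * normMoment₃ ε δ a))

/-- The moment recursion expresses the first three moments, relative to the mass, through `ε`, `δ`
and the reciprocal mass alone, which makes all later estimates algebraic. -/
theorem mul_growthRate_le {ε ε' δ : ℝ} (c d : ℝ) (h₁ : 0 ≤ ε) (h₁₂ : ε ≤ ε') (hδ : δ * ε < 1)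
    (hδ' : (δ + d * (ε' - ε)) * ε' < 1) :
    tiltMoment 0 ε δ * (1 + (ε' - ε) * growthRate c d ε ε' δ (tiltMoment 0 ε δ)⁻¹) ≤
      tiltMoment 0 ε' (δ + d * (ε' - ε)) := by
  have hV := tiltMoment_pos 0 h₁ hδ
  have hk : 0 < 1 - δ * ε := by linarith
  have e₁ : tiltMoment 1 ε δ = tiltMoment 0 ε δ * normMoment₁ ε δ (tiltMoment 0 ε δ)⁻¹ := by
    have := tiltMoment_one h₁ hδ
    rw [normMoment₁]
    field_simp
    linarith
  have e₂ : tiltMoment 2 ε δ = tiltMoment 0 ε δ * normMoment₂ ε δ (tiltMoment 0 ε δ)⁻¹ := by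
    have := tiltMoment_succ 0 h₁ hδ
    norm_num at this
    rw [normMoment₂, mul_div_assoc', eq_div_iff hk.ne', mul_comm, this, e₁]
    ring
  have e₃ : tiltMoment 3 ε δ = tiltMoment 0 ε δ * normMoment₃ ε δ (tiltMoment 0 ε δ)⁻¹ := by
    have := tiltMoment_succ 1 h₁ hδ
    norm_num at this
    rw [normMoment₃, mul_div_assoc', eq_div_iff hk.ne', mul_comm, this, e₂, e₁]
    ring
  have key := tiltMoment_zero_growth c h₁ h₁₂ hδ hδ'
  rw [e₁, e₂, e₃] at key
  refine le_trans (le_of_eq ?_) key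
  rw [growthRate]
  ring

/-- `1 - (δ + a)(ε + 2a)`, where `a` is the reciprocal of the mass of the weight. -/
noncomputable def cohenGap (ε δ : ℝ) : ℝ :=
  1 - (δ + (tiltMoment 0 ε δ)⁻¹) * (ε + 2 * (tiltMoment 0 ε δ)⁻¹)

theorem continuousAt_tiltMoment_path {δ₀ d z : ℝ} (hz : 0 < z) (hδ : (δ₀ + d * z) * z < 1) :
    ContinuousAt (fun t => tiltMoment 0 t (δ₀ + d * t)) z := by
  refine tendsto_tiltMoment_zero hz.le hδ tendsto_id ?_ ?_
  · exact (by fun_prop : Continuous fun t => δ₀ + d * t).tendsto z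
  · filter_upwards [lt_mem_nhds hz] with t ht using ht.le

theorem continuousAt_cohenGap_path {δ₀ d z : ℝ} (hz : 0 < z) (hδ : (δ₀ + d * z) * z < 1) :
    ContinuousAt (fun t => cohenGap t (δ₀ + d * t)) z := by
  have h := (continuousAt_tiltMoment_path hz hδ).inv₀ (tiltMoment_pos 0 hz.le hδ).ne'
  unfold cohenGap
  exact continuousAt_const.sub (((by fun_prop : ContinuousAt (fun t => δ₀ + d * t) z).add h).mul
    (continuousAt_id.add (continuousAt_const.mul h)))

/-- The gap increases through a zero if the growth rate is large enough there. -/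
theorem cohenGap_upcrossing {δ₀ d z c : ℝ} (hz : 0 < z) (hδ : (δ₀ + d * z) * z < 1)
    (hzero : cohenGap z (δ₀ + d * z) = 0)
    (hΦ : ∀ a, 0 < a → a = (tiltMoment 0 z (δ₀ + d * z))⁻¹ →
      (d - a * growthRate c d z z (δ₀ + d * z) a) * (z + 2 * a) +
      (δ₀ + d * z + a) * (1 - 2 * (a * growthRate c d z z (δ₀ + d * z) a)) < 0) :
    ∀ᶠ x in 𝓝 z, (x < z → cohenGap x (δ₀ + d * x) < 0) ∧
      (z < x → 0 < cohenGap x (δ₀ + d * x)) := by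
  -- Differentiability of the mass along the path is not needed: the two-point bound `A y ≤ A x - (y
  -- - x) b(x, y)` with `b` continuous at `(z, z)` suffices.
  set A : ℝ → ℝ := fun t => (tiltMoment 0 t (δ₀ + d * t))⁻¹ with hA
  have hVz := tiltMoment_pos 0 hz.le hδ
  have hAz : 0 < A z := inv_pos.2 hVz
  have hAc : ContinuousAt A z := (continuousAt_tiltMoment_path hz hδ).inv₀ hVz.ne'
  have hγ : 0 < δ₀ + d * z + A z := by
    have h : (δ₀ + d * z + A z) * (z + 2 * A z) = 1 := by
      have := hzero
      simp only [cohenGap] at this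
      linarith
    exact pos_of_mul_pos_left (h ▸ one_pos) (by positivity)
  -- the two-point growth rate, its normalized form and the resulting increment
  set g : ℝ × ℝ → ℝ := fun p => growthRate c d p.1 p.2 (δ₀ + d * p.1) (A p.1) with hg
  set b : ℝ × ℝ → ℝ := fun p => A p.1 * g p / (1 + (p.2 - p.1) * g p) with hb
  -- For `N(t) = (δ₀ + dt + A t)(t + 2 A t)` the bound on `A y` gives `N(y) ≤ N(x) + (y - x) Φ(x,
  -- y)`, and the hypothesis says `Φ(z, z) < 0`.
  set Φ : ℝ × ℝ → ℝ := fun p => (d - b p) * (p.1 + 2 * A p.1) +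
    (δ₀ + d * p.1 + A p.1) * (1 - 2 * b p) + (p.2 - p.1) * ((d - b p) * (1 - 2 * b p)) with hΦdef
  have c1 : ContinuousAt (fun p : ℝ × ℝ => p.1) (z, z) := continuousAt_fst
  have c2 : ContinuousAt (fun p : ℝ × ℝ => p.2) (z, z) := continuousAt_snd
  have cA : ContinuousAt (fun p : ℝ × ℝ => A p.1) (z, z) :=
    ContinuousAt.comp (f := Prod.fst) (g := A) hAc c1
  have cδ : ContinuousAt (fun p : ℝ × ℝ => δ₀ + d * p.1) (z, z) := by fun_prop
  have ck : ContinuousAt (fun p : ℝ × ℝ => 1 - (δ₀ + d * p.1) * p.1) (z, z) := by fun_prop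
  have hk : 1 - (δ₀ + d * z) * z ≠ 0 := by linarith
  have cm1 : ContinuousAt (fun p : ℝ × ℝ => normMoment₁ p.1 (δ₀ + d * p.1) (A p.1)) (z, z) :=
    ((cδ.add c1).add cA).div ck hk
  have cm2 : ContinuousAt (fun p : ℝ × ℝ => normMoment₂ p.1 (δ₀ + d * p.1) (A p.1)) (z, z) :=
    (((cδ.add (c1.const_mul 2)).mul cm1).add_const 1).div ck hk
  have cm3 : ContinuousAt (fun p : ℝ × ℝ => normMoment₃ p.1 (δ₀ + d * p.1) (A p.1)) (z, z) :=
    (((cδ.add (c1.const_mul 3)).mul cm2).add (cm1.const_mul 2)).div ck hk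
  have cg : ContinuousAt g (z, z) :=
    (cm1.const_mul d).add ((cm2.const_mul c).sub (((cm1.add (((c1.add c2).div_const 2).mul cm2)).add
      (((c1.mul c2).div_const 3).mul cm3)).const_mul (c ^ 2)))
  have cden : ContinuousAt (fun p : ℝ × ℝ => 1 + (p.2 - p.1) * g p) (z, z) :=
    continuousAt_const.add ((c2.sub c1).mul cg)
  have cb : ContinuousAt b (z, z) := (cA.mul cg).div cden (by simp)
  have cΦ : ContinuousAt Φ (z, z) :=
    (((continuousAt_const.sub cb).mul (c1.add (cA.const_mul 2))).add ((cδ.add cA).mul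
      (continuousAt_const.sub (cb.const_mul 2)))).add ((c2.sub c1).mul
        ((continuousAt_const.sub cb).mul (continuousAt_const.sub (cb.const_mul 2))))
  have hΦz : Φ (z, z) < 0 := by
    have := hΦ (A z) hAz rfl
    simpa [hΦdef, hb, hg] using this
  have ev1 := cΦ.eventually (gt_mem_nhds hΦz)
  have ev2 := cden.eventually (lt_mem_nhds (by simp : (0 : ℝ) < 1 + (z - z) * g (z, z)))
  have ev3 : ∀ᶠ t in 𝓝 z, 0 < t ∧ (δ₀ + d * t) * t < 1 ∧ 0 < δ₀ + d * t + A t := by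
    refine (lt_mem_nhds hz).and (((by fun_prop : ContinuousAt (fun t => (δ₀ + d * t) * t) z).eventually
      (gt_mem_nhds hδ)).and (((by fun_prop : ContinuousAt (fun t => δ₀ + d * t) z).add
        hAc).eventually (lt_mem_nhds hγ)))
  -- strict monotonicity near `z`
  have hmono : ∀ x y, x < y → Φ (x, y) < 0 → 0 < 1 + (y - x) * g (x, y) →
      (0 < x ∧ (δ₀ + d * x) * x < 1 ∧ 0 < δ₀ + d * x + A x) →
      (0 < y ∧ (δ₀ + d * y) * y < 1 ∧ 0 < δ₀ + d * y + A y) →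
      cohenGap x (δ₀ + d * x) < cohenGap y (δ₀ + d * y) := by
    intro x y hxy h1 h2 hx hy
    have hVx := tiltMoment_pos 0 hx.1.le hx.2.1
    have hVy := tiltMoment_pos 0 hy.1.le hy.2.1
    have heq : δ₀ + d * x + d * (y - x) = δ₀ + d * y := by ring
    have hgr := mul_growthRate_le c d hx.1.le hxy.le hx.2.1 (by rw [heq]; exact hy.2.1)
    rw [heq] at hgr
    have hAy : A y ≤ A x - (y - x) * b (x, y) := by
      have e : A x - (y - x) * b (x, y) =
          (tiltMoment 0 x (δ₀ + d * x) * (1 + (y - x) * g (x, y)))⁻¹ := by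
        simp only [hb, mul_inv]
        rw [show A x = (tiltMoment 0 x (δ₀ + d * x))⁻¹ from rfl]
        field_simp
        ring
      rw [e]
      exact inv_anti₀ (mul_pos hVx h2) hgr
    have hAyp : 0 < A y := inv_pos.2 hVy
    have hN : (δ₀ + d * y + A y) * (y + 2 * A y) ≤
        (δ₀ + d * y + (A x - (y - x) * b (x, y))) * (y + 2 * (A x - (y - x) * b (x, y))) :=
      mul_le_mul (by linarith) (by linarith) (by linarith [hy.1]) (by linarith [hy.2.2])
    have hid : (δ₀ + d * y + (A x - (y - x) * b (x, y))) *
        (y + 2 * (A x - (y - x) * b (x, y))) =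
        (δ₀ + d * x + A x) * (x + 2 * A x) + (y - x) * Φ (x, y) := by
      simp only [hΦdef]
      ring
    have hneg : (y - x) * Φ (x, y) < 0 := mul_neg_of_pos_of_neg (by linarith) h1
    simp only [cohenGap]
    change 1 - (δ₀ + d * x + A x) * (x + 2 * A x) < 1 - (δ₀ + d * y + A y) * (y + 2 * A y)
    linarith
  have cl : ContinuousAt (fun x : ℝ => (x, z)) z := by fun_prop
  have cr : ContinuousAt (fun x : ℝ => (z, x)) z := by fun_prop
  have evz := ev3.self_of_nhds
  filter_upwards [ev3, cl.eventually ev1, cl.eventually ev2, cr.eventually ev1,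
    cr.eventually ev2] with x h0 h1 h2 h3 h4
  exact ⟨fun hlt => hzero ▸ hmono x z hlt h1 h2 h0 evz,
    fun hlt => hzero ▸ hmono z x hlt h3 h4 evz h0⟩

/-! ### The polynomial inequalities at a zero of the gap. -/

theorem half_lt_mul_growthRate {ε δ a : ℝ} (hε : 0 < ε) (ha : 0 < a) (hδ : 0 ≤ δ)
    (h : (δ + a) * (ε + 2 * a) = 1) :
    ∃ c, 1 / 2 < a * growthRate c (1 / 2) ε ε δ a := by
  obtain ⟨γ, hγ⟩ : ∃ γ, γ = δ + a := ⟨_, rfl⟩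
  obtain ⟨p₁, hp₁⟩ : ∃ p, p = γ + ε := ⟨_, rfl⟩
  obtain ⟨k, hk⟩ : ∃ k, k = a * (2 * γ + ε) := ⟨_, rfl⟩
  obtain ⟨p₂, hp₂⟩ : ∃ p, p = (δ + 2 * ε) * p₁ + k := ⟨_, rfl⟩
  obtain ⟨p₃, hp₃⟩ : ∃ p, p = (δ + 3 * ε) * p₂ + 2 * k * p₁ := ⟨_, rfl⟩
  have hγ0 : 0 < γ := by rw [hγ]; positivity
  have hk0 : 0 < k := by rw [hk]; positivity
  have hp₁0 : 0 < p₁ := by rw [hp₁]; positivity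
  have hp₂0 : 0 < p₂ := by rw [hp₂]; positivity
  have hp₃0 : 0 < p₃ := by rw [hp₃]; positivity
  -- At a zero of the gap the denominator `1 - δε` factors as `a(2γ + ε)`, so the `i`-th normalized
  -- moment is `pᵢ/kⁱ` with `pᵢ` polynomial.
  have hk' : 1 - δ * ε = k := by rw [hk, ← h, hγ]; ring
  have n₁ : normMoment₁ ε δ a = p₁ / k := by rw [normMoment₁, hk', hp₁, hγ]; ring
  have n₂ : normMoment₂ ε δ a = p₂ / k ^ 2 := by
    rw [normMoment₂, hk', n₁, hp₂]; field_simp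
  have n₃ : normMoment₃ ε δ a = p₃ / k ^ 3 := by
    rw [normMoment₃, hk', n₁, n₂, hp₃]; field_simp
  obtain ⟨Q, hQ⟩ : ∃ Q, Q = k ^ 2 * p₁ + k * ε * p₂ + ε ^ 2 * p₃ / 3 := ⟨_, rfl⟩
  have hQ0 : 0 < Q := by rw [hQ]; positivity
  have hpoly : 2 * Q < (ε + 2 * a) * p₂ ^ 2 := by
    rw [← sub_pos]
    have : (ε + 2 * a) * p₂ ^ 2 - 2 * Q =
        14 / 3 * δ * ε ^ 4 + 9 * δ ^ 2 * ε ^ 3 + 16 / 3 * δ ^ 3 * ε ^ 2 + δ ^ 4 * ε +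
        26 / 3 * a * ε ^ 4 + 28 * a * δ * ε ^ 3 + 94 / 3 * a * δ ^ 2 * ε ^ 2 +
        14 * a * δ ^ 3 * ε + 2 * a * δ ^ 4 + 17 * a ^ 2 * ε ^ 3 + 130 / 3 * a ^ 2 * δ * ε ^ 2 +
        29 * a ^ 2 * δ ^ 2 * ε + 4 * a ^ 2 * δ ^ 3 + 52 / 3 * a ^ 3 * ε ^ 2 +
        20 * a ^ 3 * δ * ε + 2 * a ^ 3 * δ ^ 2 + 4 * a ^ 4 * ε := by
      rw [hQ, hp₃, hp₂, hp₁, hk, hγ]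
      ring
    rw [this]
    positivity
  have hpoly' : 2 * γ * Q < p₂ ^ 2 := by
    have := mul_lt_mul_of_pos_left hpoly hγ0
    have e : γ * ((ε + 2 * a) * p₂ ^ 2) = p₂ ^ 2 := by
      rw [← mul_assoc, hγ, h, one_mul]
    linarith
  -- This is the maximizer of the quadratic `c · p₂/k² - c² · Q/k³`.
  refine ⟨p₂ * k / (2 * Q), ?_⟩
  have : a * growthRate (p₂ * k / (2 * Q)) (1 / 2) ε ε δ a - 1 / 2 =
      (p₂ ^ 2 - 2 * γ * Q) / (4 * (2 * γ + ε) * Q) := by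
    have e : normMoment₁ ε δ a + (ε + ε) / 2 * normMoment₂ ε δ a +
        ε * ε / 3 * normMoment₃ ε δ a = Q / k ^ 3 := by
      rw [n₁, n₂, n₃, hQ]; field_simp; ring
    rw [growthRate, e, n₁, n₂]
    have ha' : a = k / (2 * γ + ε) := by rw [hk]; field_simp
    rw [ha', hp₁]
    field_simp
    ring
  have h2 : 0 < (p₂ ^ 2 - 2 * γ * Q) / (4 * (2 * γ + ε) * Q) :=
    div_pos (by linarith) (by positivity)
  linarith

theorem lt_mul_growthRate {ε δ a : ℝ} (hε : 0 < ε) (hε1 : ε ≤ 1) (ha : 0 < a) (hδ : δ ≤ 0)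
    (h : (δ + a) * (ε + 2 * a) = 1) :
    ∃ c, δ + a < a * growthRate c 0 ε ε δ a * (ε + 2 * a + 2 * (δ + a)) := by
  obtain ⟨γ, hγ⟩ : ∃ γ, γ = δ + a := ⟨_, rfl⟩
  obtain ⟨t, ht⟩ : ∃ t, t = -δ := ⟨_, rfl⟩
  obtain ⟨p₁, hp₁⟩ : ∃ p, p = γ + ε := ⟨_, rfl⟩
  obtain ⟨k, hk⟩ : ∃ k, k = a * (2 * γ + ε) := ⟨_, rfl⟩
  obtain ⟨p₂, hp₂⟩ : ∃ p, p = (δ + 2 * ε) * p₁ + k := ⟨_, rfl⟩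
  obtain ⟨p₃, hp₃⟩ : ∃ p, p = (δ + 3 * ε) * p₂ + 2 * k * p₁ := ⟨_, rfl⟩
  have ht0 : 0 ≤ t := by linarith
  have hγ0 : 0 < γ := by rw [hγ]; exact pos_of_mul_pos_left (h ▸ one_pos) (by positivity)
  have haγ : a = γ + t := by linarith
  have hδt : δ = -t := by linarith
  have hk0 : 0 < k := by rw [hk]; positivity
  have hp₁0 : 0 < p₁ := by rw [hp₁]; positivity
  have hp₂0 : 0 < p₂ := by
    have : p₂ = 2 * ε * p₁ + 2 * γ ^ 2 + γ * ε + t * γ := by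
      rw [hp₂, hk, hp₁, hδt, haγ]; ring
    rw [this]; positivity
  have hk' : 1 - δ * ε = k := by rw [hk, ← h, hγ]; ring
  have n₁ : normMoment₁ ε δ a = p₁ / k := by rw [normMoment₁, hk', hp₁, hγ]; ring
  have n₂ : normMoment₂ ε δ a = p₂ / k ^ 2 := by
    rw [normMoment₂, hk', n₁, hp₂]; field_simp
  have n₃ : normMoment₃ ε δ a = p₃ / k ^ 3 := by
    rw [normMoment₃, hk', n₁, n₂, hp₃]; field_simp
  obtain ⟨Q, hQ⟩ : ∃ Q, Q = k ^ 2 * p₁ + k * ε * p₂ + ε ^ 2 * p₃ / 3 := ⟨_, rfl⟩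
  have hQ0 : 0 < Q := by
    have : Q = 4 * γ ^ 5 + 8 * γ ^ 4 * t + 12 * γ ^ 4 * ε + 4 * γ ^ 3 * t ^ 2 +
        22 * γ ^ 3 * t * ε + 43 / 3 * γ ^ 3 * ε ^ 2 + 10 * γ ^ 2 * t ^ 2 * ε +
        59 / 3 * γ ^ 2 * t * ε ^ 2 + 12 * γ ^ 2 * ε ^ 3 + 17 / 3 * γ * t ^ 2 * ε ^ 2 +
        11 * γ * t * ε ^ 3 + 17 / 3 * γ * ε ^ 4 + t ^ 2 * ε ^ 3 + 2 * t * ε ^ 4 + 2 * ε ^ 5 := by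
      rw [hQ, hp₃, hp₂, hp₁, hk, haγ, hδt]
      ring
    rw [this]
    positivity
  -- Here `ε ≤ 1` enters, through `ε² ≤ 1 = γ(ε + 2a)`. A multiple of this relation absorbs the
  -- negative terms in `hpoly`.
  have hrel : 0 ≤ γ * (ε + 2 * a) - ε ^ 2 := by
    rw [hγ, h]
    nlinarith
  have hpoly : 4 * (2 * γ + ε) * Q < (ε + 2 * a + 2 * γ) * (ε + 2 * a) * p₂ ^ 2 := by
    rw [← sub_pos]
    have : (ε + 2 * a + 2 * γ) * (ε + 2 * a) * p₂ ^ 2 - 4 * (2 * γ + ε) * Q =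
        (4 * ε ^ 4 + 20 / 3 * γ * ε ^ 3) * (γ * (ε + 2 * a) - ε ^ 2) +
        (16 * γ ^ 5 * t + 8 * γ ^ 5 * ε + 40 * γ ^ 4 * t ^ 2 + 24 * γ ^ 4 * t * ε +
        148 / 3 * γ ^ 4 * ε ^ 2 + 28 * γ ^ 3 * t ^ 3 + 46 * γ ^ 3 * t ^ 2 * ε +
        236 / 3 * γ ^ 3 * t * ε ^ 2 + 130 / 3 * γ ^ 3 * ε ^ 3 + 4 * γ ^ 2 * t ^ 4 +
        28 * γ ^ 2 * t ^ 3 * ε + 167 / 3 * γ ^ 2 * t ^ 2 * ε ^ 2 + 62 * γ ^ 2 * t * ε ^ 3 +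
        13 * γ ^ 2 * ε ^ 4 + 16 * γ * t ^ 3 * ε ^ 2 + 100 / 3 * γ * t ^ 2 * ε ^ 3 +
        32 * γ * t * ε ^ 4 + 12 * t ^ 2 * ε ^ 4 + 8 * t * ε ^ 5) := by
      rw [hQ, hp₃, hp₂, hp₁, hk, haγ, hδt]
      ring
    rw [this]
    positivity
  have hpoly' : γ * (4 * (2 * γ + ε) * Q) < (ε + 2 * a + 2 * γ) * p₂ ^ 2 := by
    have := mul_lt_mul_of_pos_left hpoly hγ0
    have e : γ * ((ε + 2 * a + 2 * γ) * (ε + 2 * a) * p₂ ^ 2) =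
        (δ + a) * (ε + 2 * a) * ((ε + 2 * a + 2 * γ) * p₂ ^ 2) := by rw [hγ]; ring
    rwa [e, h, one_mul] at this
  refine ⟨p₂ * k / (2 * Q), ?_⟩
  have : a * growthRate (p₂ * k / (2 * Q)) 0 ε ε δ a = p₂ ^ 2 / (4 * (2 * γ + ε) * Q) := by
    have e : normMoment₁ ε δ a + (ε + ε) / 2 * normMoment₂ ε δ a +
        ε * ε / 3 * normMoment₃ ε δ a = Q / k ^ 3 := by
      rw [n₁, n₂, n₃, hQ]; field_simp; ring
    rw [growthRate, e, n₁, n₂]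
    have ha' : a = k / (2 * γ + ε) := by rw [hk]; field_simp
    rw [ha']
    field_simp
    ring
  rw [this, ← hγ, div_mul_eq_mul_div, lt_div_iff₀ (by positivity)]
  linarith

/-! ### Identification with the Erlang B formula at `ε = 1/√s`. -/

theorem tiltExponent_eq {ε y : ℝ} (hε : 0 < ε) (hy : 0 ≤ y) :
    tiltExponent ε y = y / ε - Real.log (1 + ε * y) / ε ^ 2 := by
  have hd : ∀ x, 0 ≤ x → HasDerivAt
      (fun x => tiltExponent ε x - (x / ε - Real.log (1 + ε * x) / ε ^ 2)) 0 x := by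
    intro x hx
    have hq : 1 + ε * x ≠ 0 := by positivity
    have h1 := ((((hasDerivAt_id x).const_mul ε).const_add 1).log hq).div_const (ε ^ 2)
    refine ((hasDerivAt_tiltExponent hε.le hx).sub (((hasDerivAt_id x).div_const ε).sub
      h1)).congr_deriv ?_
    simp only [id]
    field_simp
    ring
  have h1 := le_of_hasDerivAt_nonneg hd (fun _ _ => le_rfl) hy
  have h2 := le_of_hasDerivAt_nonneg (fun x hx => (hd x hx).neg) (fun _ _ => by simp) hy
  simp at h1 h2
  linarith

/-- Since `1/ε² = s` is an integer, the logarithm exponentiates to `(1 + εy)^s`, which is expanded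
by the binomial theorem. -/
theorem tiltWeight_inv_sqrt {s : ℕ} (hs : 1 ≤ s) (δ : ℝ) {y : ℝ} (hy : 0 ≤ y) :
    tiltWeight (1 / √s) δ y = ∑ k ∈ Finset.range (s + 1),
      (s.choose k * (1 / √s) ^ k) * (y ^ k * Real.exp (-(√s - δ) * y)) := by
  have hs0 : (0 : ℝ) < s := by exact_mod_cast hs
  have hr : 0 < √(s : ℝ) := Real.sqrt_pos.2 hs0
  have hq : 0 < 1 + 1 / √(s : ℝ) * y := by positivity
  rw [tiltWeight, tiltExponent_eq (by positivity) hy]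
  have e : δ * y - (y / (1 / √(s : ℝ)) - Real.log (1 + 1 / √(s : ℝ) * y) / (1 / √(s : ℝ)) ^ 2) =
      Real.log ((1 + 1 / √(s : ℝ) * y) ^ s) + -(√s - δ) * y := by
    rw [Real.log_pow, div_pow, Real.sq_sqrt hs0.le]
    field_simp
    ring
  rw [e, Real.exp_add, Real.exp_log (by positivity), add_comm (1 : ℝ), add_pow, Finset.sum_mul]
  refine Finset.sum_congr rfl fun k _ => ?_
  rw [mul_pow]
  ring

theorem integral_pow_mul_exp_neg_mul (k : ℕ) {κ : ℝ} (hκ : 0 < κ) :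
    ∫ y in Ioi (0 : ℝ), y ^ k * Real.exp (-κ * y) = k.factorial / κ ^ (k + 1) := by
  have := Real.integral_rpow_mul_exp_neg_mul_Ioi (a := k + 1) (r := κ) (by positivity) hκ
  rw [Real.Gamma_nat_eq_factorial, add_sub_cancel_right] at this
  simp only [Real.rpow_natCast, ← neg_mul] at this
  rw [this, ← Nat.cast_succ, Real.rpow_natCast, one_div, inv_pow, div_eq_mul_inv, mul_comm]

/-- The mass of the weight at `ε = 1/√s` is the reciprocal of the scaled loss probability. -/
theorem inv_tiltMoment_eq {s : ℕ} (hs : 1 ≤ s) {δ : ℝ} (hδ : δ < √s) :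
    (tiltMoment 0 (1 / √s) δ)⁻¹ = (√s - δ) * erlangB s (s - δ * √s) := by
  have hs0 : (0 : ℝ) < s := by exact_mod_cast hs
  have hr : 0 < √(s : ℝ) := Real.sqrt_pos.2 hs0
  have hκ : 0 < √(s : ℝ) - δ := by linarith
  have hlam : (s : ℝ) - δ * √s = (√s - δ) * √s := by
    rw [sub_mul, Real.mul_self_sqrt hs0.le]
  have hV : tiltMoment 0 (1 / √s) δ = ∑ k ∈ Finset.range (s + 1),
      (s.choose k * (1 / √s) ^ k) * (k.factorial / (√s - δ) ^ (k + 1)) := by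
    have h1 : tiltMoment 0 (1 / √s) δ = ∫ y in Ioi (0 : ℝ), ∑ k ∈ Finset.range (s + 1),
      (s.choose k * (1 / √s) ^ k) * (y ^ k * Real.exp (-(√s - δ) * y)) := by
      refine MeasureTheory.setIntegral_congr_fun measurableSet_Ioi fun y hy => ?_
      simp only [pow_zero, one_mul]
      exact tiltWeight_inv_sqrt hs δ (le_of_lt hy)
    rw [h1, MeasureTheory.integral_finsetSum _ fun k _ =>
      (integrableOn_pow_mul_exp_neg_mul k hκ).const_mul _]
    refine Finset.sum_congr rfl fun k _ => ?_
    rw [MeasureTheory.integral_const_mul, integral_pow_mul_exp_neg_mul k hκ]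
  rw [erlangB, hV, hlam]
  set κ := √(s : ℝ) - δ with hκdef
  set r := √(s : ℝ) with hrdef
  have hsum : ∑ k ∈ Finset.range (s + 1), (κ * r) ^ k / (k.factorial : ℝ) =
      κ * ((κ * r) ^ s / s.factorial) * ∑ k ∈ Finset.range (s + 1),
        (s.choose k * (1 / r) ^ k) * (k.factorial / κ ^ (k + 1)) := by
    -- Reversing the order matches the term of index `s - k` with `choose s k * k! = s!/(s - k)!`.
    rw [← Finset.sum_range_reflect, Finset.mul_sum]
    refine Finset.sum_congr rfl fun k hk => ?_
    have hk : k ≤ s := Nat.lt_succ_iff.1 (Finset.mem_range.1 hk)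
    rw [show s + 1 - 1 - k = s - k by omega, Nat.cast_choose ℝ hk]
    have e : (κ * r) ^ s = (κ * r) ^ (s - k) * (κ * r) ^ k := by
      rw [← pow_add, Nat.sub_add_cancel hk]
    have f1 : ((s - k).factorial : ℝ) ≠ 0 := by positivity
    have f2 : (k.factorial : ℝ) ≠ 0 := by positivity
    have f3 : (s.factorial : ℝ) ≠ 0 := by positivity
    rw [e, mul_pow κ r k]
    field_simp
    rw [pow_succ]
    field_simp
    rw [← mul_pow, mul_one_div_cancel hr.ne', one_pow]
  rw [hsum]
  have hSpos : 0 < ∑ k ∈ Finset.range (s + 1),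
      (s.choose k * (1 / r) ^ k) * (k.factorial / κ ^ (k + 1)) := by
    refine Finset.sum_pos (fun k hk => ?_) ⟨0, by simp⟩
    have := Nat.choose_pos (Nat.lt_succ_iff.1 (Finset.mem_range.1 hk))
    positivity
  field_simp

/-! ### Sign of the gap along the two kinds of lines. -/

theorem continuousOn_cohenGap_path {δ₀ d x₀ x₁ : ℝ} (hx₀ : 0 < x₀)
    (h : ∀ t ∈ Icc x₀ x₁, (δ₀ + d * t) * t < 1) :
    ContinuousOn (fun t => cohenGap t (δ₀ + d * t)) (Icc x₀ x₁) := fun t ht =>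
  (continuousAt_cohenGap_path (hx₀.trans_le ht.1) (h t ht)).continuousWithinAt

theorem cohenGap_one {δ : ℝ} (hδ : δ < 1) : cohenGap 1 δ = δ * (1 - δ) / (2 - δ) ^ 2 := by
  have h := inv_tiltMoment_eq (s := 1) le_rfl (δ := δ) (by simpa using hδ)
  simp only [Nat.cast_one, Real.sqrt_one, div_one, mul_one] at h
  have hq : 0 < 2 - δ := by linarith
  have hq' : 1 + (1 - δ) ≠ 0 := by linarith
  rw [cohenGap, h, erlangB]
  norm_num [Finset.sum_range_succ]
  field_simp
  ring

/-- Hold `δ` fixed and move `ε` up to `1`, where `cohenGap_one` shows the gap to be nonpositive;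
every zero on the way is an upcrossing. -/
theorem cohenGap_neg {ε δ : ℝ} (hε : 0 < ε) (hε1 : ε < 1) (hδ : δ ≤ 0) : cohenGap ε δ < 0 := by
  have hlt : ∀ t, 0 < t → δ * t < 1 := fun t ht => by nlinarith
  have key := neg_of_upcrossing (F := fun t => cohenGap t (δ + 0 * t)) (x₀ := ε) (x₁ := 1)
    (continuousOn_cohenGap_path hε fun t ht => by
      simpa using hlt t (hε.trans_le ht.1))
    (fun z hz hzero => by
      have hz0 : 0 < z := hε.trans_le hz.1
      have hδz : (δ + 0 * z) * z < 1 := by simpa using hlt z hz0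
      have ha := inv_pos.2 (tiltMoment_pos 0 hz0.le hδz)
      have hone : (δ + 0 * z + (tiltMoment 0 z (δ + 0 * z))⁻¹) *
          (z + 2 * (tiltMoment 0 z (δ + 0 * z))⁻¹) = 1 := by
        simp only [cohenGap] at hzero; linarith
      obtain ⟨c, hc⟩ := lt_mul_growthRate hz0 hz.2 ha (by simpa using hδ) hone
      refine cohenGap_upcrossing (c := c) hz0 hδz hzero fun a _ haeq => ?_
      rw [← haeq] at hc
      linarith)
    (by
      simp only [zero_mul, add_zero]
      rw [cohenGap_one (by linarith)]
      refine div_nonpos_of_nonpos_of_nonneg ?_ (by positivity)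
      nlinarith) ε ⟨le_rfl, hε1⟩
  simpa using key

theorem cohenGap_path_neg {δ₀ x₀ x₁ : ℝ} (hx₀ : 0 < x₀) (h₀₁ : x₀ < x₁) (hx₁ : x₁ ≤ 1)
    (hδ : ∀ t ∈ Icc x₀ x₁, (δ₀ + 1 / 2 * t) * t < 1) (hδ₁ : 0 ≤ δ₀ + 1 / 2 * x₁)
    (h : cohenGap x₁ (δ₀ + 1 / 2 * x₁) ≤ 0) : cohenGap x₀ (δ₀ + 1 / 2 * x₀) < 0 := by
  refine neg_of_upcrossing (F := fun t => cohenGap t (δ₀ + 1 / 2 * t)) (x₀ := x₀) (x₁ := x₁)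
    (continuousOn_cohenGap_path hx₀ hδ) (fun z hz hzero => ?_) h x₀ ⟨le_rfl, h₀₁⟩
  have hz0 : 0 < z := hx₀.trans_le hz.1
  have hδz := hδ z hz
  have ha := inv_pos.2 (tiltMoment_pos 0 hz0.le hδz)
  have hone : (δ₀ + 1 / 2 * z + (tiltMoment 0 z (δ₀ + 1 / 2 * z))⁻¹) *
      (z + 2 * (tiltMoment 0 z (δ₀ + 1 / 2 * z))⁻¹) = 1 := by
    simp only [cohenGap] at hzero; linarith
  -- A zero inside the path cannot have `δ < 0`, because the gap is strictly negative there.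
  have hδ0 : 0 ≤ δ₀ + 1 / 2 * z := by
    rcases hz.2.eq_or_lt with rfl | hlt
    · exact hδ₁
    · by_contra hneg
      have := cohenGap_neg hz0 (hlt.trans_le hx₁) (not_le.1 hneg).le
      linarith
  obtain ⟨c, hc⟩ := half_lt_mul_growthRate hz0 ha hδ0 hone
  refine cohenGap_upcrossing (c := c) hz0 hδz hzero fun a hap haeq => ?_
  rw [← haeq] at hc hone
  nlinarith [mul_pos (sub_pos.2 hc) (by positivity : 0 < z + 2 * a),
    mul_pos (sub_pos.2 hc) (pos_of_mul_pos_left (hone ▸ one_pos) (by positivity) :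
      0 < δ₀ + 1 / 2 * z + a)]

/-! ### The Erlang B recursion and the carried load. -/

theorem erlangB_zero (lam : ℝ) : erlangB 0 lam = 1 := by simp [erlangB]

theorem erlangB_pos (s : ℕ) {lam : ℝ} (h : 0 < lam) : 0 < erlangB s lam := by
  have : 0 < ∑ k ∈ Finset.range (s + 1), lam ^ k / (k.factorial : ℝ) :=
    Finset.sum_pos (fun k _ => by positivity) ⟨0, by simp⟩
  unfold erlangB
  positivity

theorem erlangB_succ (s : ℕ) {lam : ℝ} (h : 0 < lam) :
    erlangB (s + 1) lam = lam * erlangB s lam / (s + 1 + lam * erlangB s lam) := by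
  have hS : 0 < ∑ k ∈ Finset.range (s + 1), lam ^ k / (k.factorial : ℝ) :=
    Finset.sum_pos (fun k _ => by positivity) ⟨0, by simp⟩
  unfold erlangB
  rw [Finset.sum_range_succ _ (s + 1)]
  set S := ∑ k ∈ Finset.range (s + 1), lam ^ k / (k.factorial : ℝ)
  have e : lam ^ (s + 1) / ((s + 1).factorial : ℝ) =
      lam * (lam ^ s / (s.factorial : ℝ)) / (s + 1) := by
    rw [Nat.factorial_succ, pow_succ]
    push_cast
    field_simp
  rw [e]
  set t := lam ^ s / (s.factorial : ℝ) with ht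
  have ht0 : 0 < t := by positivity
  field_simp

theorem erlangB_le_one (s : ℕ) {lam : ℝ} (h : 0 < lam) : erlangB s lam ≤ 1 := by
  cases s with
  | zero => rw [erlangB_zero]
  | succ s =>
    have := erlangB_pos s h
    rw [erlangB_succ s h, div_le_one (by positivity)]
    have : (0 : ℝ) ≤ s := s.cast_nonneg
    linarith

theorem erlangB_le_self {s : ℕ} (hs : 1 ≤ s) {lam : ℝ} (h : 0 < lam) : erlangB s lam ≤ lam := by
  obtain ⟨s, rfl⟩ := Nat.exists_eq_add_of_le' hs
  have h0 := erlangB_pos s h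
  have h1 := erlangB_le_one s h
  have hs0 : (0 : ℝ) ≤ s := s.cast_nonneg
  rw [erlangB_succ s h, div_le_iff₀ (by positivity)]
  have := mul_le_mul_of_nonneg_left h1 h.le
  have : 0 ≤ lam * (s + lam * erlangB s lam) := by positivity
  nlinarith

/-- The carried load `lam (1 - B(s, lam))`. -/
noncomputable def carriedLoad (s : ℕ) (lam : ℝ) : ℝ := lam * (1 - erlangB s lam)

theorem carriedLoad_zero (lam : ℝ) : carriedLoad 0 lam = 0 := by
  simp [carriedLoad, erlangB_zero]

theorem carriedLoad_lt_self (s : ℕ) {lam : ℝ} (h : 0 < lam) : carriedLoad s lam < lam := by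
  have := mul_pos h (erlangB_pos s h)
  unfold carriedLoad
  linarith

theorem carriedLoad_succ (s : ℕ) {lam : ℝ} (h : 0 < lam) :
    carriedLoad (s + 1) lam = (s + 1) * lam / (s + 1 + (lam - carriedLoad s lam)) := by
  have hB := erlangB_pos s h
  unfold carriedLoad
  rw [erlangB_succ s h]
  have e : lam - lam * (1 - erlangB s lam) = lam * erlangB s lam := by ring
  rw [e]
  field_simp
  ring

theorem carriedLoad_le (s : ℕ) {lam : ℝ} (h : 0 < lam) : carriedLoad s lam ≤ s := by
  induction s with
  | zero => simp [carriedLoad_zero]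
  | succ s ih =>
    have := carriedLoad_lt_self s h
    have hs0 : (0 : ℝ) ≤ s := s.cast_nonneg
    rw [carriedLoad_succ s h, div_le_iff₀ (by linarith)]
    push_cast
    nlinarith

theorem carriedLoad_lt {s : ℕ} (hs : 1 ≤ s) {lam : ℝ} (h : 0 < lam) : carriedLoad s lam < s := by
  obtain ⟨s, rfl⟩ := Nat.exists_eq_add_of_le' hs
  have h1 := carriedLoad_lt_self s h
  have h2 := carriedLoad_le s h
  have hs0 : (0 : ℝ) ≤ s := s.cast_nonneg
  rw [carriedLoad_succ s h, div_lt_iff₀ (by linarith)]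
  push_cast
  nlinarith

theorem carriedLoad_pos {s : ℕ} (hs : 1 ≤ s) {lam : ℝ} (h : 0 < lam) : 0 < carriedLoad s lam := by
  obtain ⟨s, rfl⟩ := Nat.exists_eq_add_of_le' hs
  have h1 := carriedLoad_lt_self s h
  have hs0 : (0 : ℝ) ≤ s := s.cast_nonneg
  rw [carriedLoad_succ s h]
  exact div_pos (by positivity) (by linarith)

theorem carriedLoad_mul_le {s : ℕ} (hs : 1 ≤ s) {lam : ℝ} (h : 0 < lam) :
    carriedLoad s lam ≤ (s - carriedLoad s lam) * lam := by
  obtain ⟨s, rfl⟩ := Nat.exists_eq_add_of_le' hs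
  have h1 := carriedLoad_lt_self s h
  have h2 := carriedLoad_le s h
  have hs0 : (0 : ℝ) ≤ s := s.cast_nonneg
  have hD : 0 < s + 1 + (lam - carriedLoad s lam) := by linarith
  have e := carriedLoad_succ s h
  rw [eq_div_iff hD.ne'] at e
  have hC := carriedLoad_pos hs h
  push_cast
  nlinarith [mul_nonneg hC.le (sub_nonneg.2 h2)]

/-- The difference of the two sides is `lam` times the derivative of the carried load. At `s + 1` it
is a positive multiple of `s + 1 - (lam - C)(s - C)`, with `C` the carried load of `s` servers, and
the induction hypothesis with `C ≤ s` makes this positive. -/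
theorem carriedLoad_overflow_le (s : ℕ) {lam : ℝ} (h : 0 < lam) :
    (lam - carriedLoad s lam) * (s - carriedLoad s lam) ≤ carriedLoad s lam ∧
    (1 ≤ s → (lam - carriedLoad s lam) * (s - carriedLoad s lam) < carriedLoad s lam) := by
  induction s with
  | zero => simp [carriedLoad_zero]
  | succ s ih =>
    have h1 := carriedLoad_lt_self s h
    have h2 := carriedLoad_le s h
    have hs0 : (0 : ℝ) ≤ s := s.cast_nonneg
    have hD : 0 < s + 1 + (lam - carriedLoad s lam) := by linarith
    have key : (lam - carriedLoad (s + 1) lam) * ((s + 1 : ℕ) - carriedLoad (s + 1) lam) <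
        carriedLoad (s + 1) lam := by
      rw [carriedLoad_succ s h]
      set c := carriedLoad s lam
      have e : (s + 1) * lam / (s + 1 + (lam - c)) -
          (lam - (s + 1) * lam / (s + 1 + (lam - c))) *
            ((s + 1 : ℕ) - (s + 1) * lam / (s + 1 + (lam - c))) =
          (s + 1) * lam * (s + 1 - (lam - c) * (s - c)) / (s + 1 + (lam - c)) ^ 2 := by
        push_cast
        field_simp
        ring
      have : 0 < (s + 1) * lam * (s + 1 - (lam - c) * (s - c)) / (s + 1 + (lam - c)) ^ 2 := by
        have : 0 < s + 1 - (lam - c) * (s - c) := by linarith [ih.1]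
        positivity
      linarith
    exact ⟨key.le, fun _ => key⟩

theorem hasDerivAt_carriedLoad (s : ℕ) {lam : ℝ} (h : 0 < lam) :
    HasDerivAt (carriedLoad s) ((carriedLoad s lam -
      (lam - carriedLoad s lam) * (s - carriedLoad s lam)) / lam) lam := by
  induction s with
  | zero =>
    have : carriedLoad 0 = fun _ => 0 := funext carriedLoad_zero
    rw [this]
    simpa using hasDerivAt_const lam (0 : ℝ)
  | succ s ih =>
    have h1 := carriedLoad_lt_self s h
    have hs0 : (0 : ℝ) ≤ s := s.cast_nonneg
    have hD : 0 < s + 1 + (lam - carriedLoad s lam) := by linarith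
    have hd := ((hasDerivAt_id lam).const_mul ((s : ℝ) + 1)).div
      (((hasDerivAt_id lam).sub ih).const_add ((s : ℝ) + 1)) hD.ne'
    have hev : carriedLoad (s + 1) =ᶠ[𝓝 lam]
        fun l => (s + 1) * l / (s + 1 + (l - carriedLoad s l)) := by
      filter_upwards [lt_mem_nhds h] with l hl using carriedLoad_succ s hl
    refine (HasDerivAt.congr_of_eventuallyEq hd hev).congr_deriv ?_
    rw [carriedLoad_succ s h]
    simp only [id, Pi.sub_apply]
    set c := carriedLoad s lam
    push_cast
    field_simp
    ring

theorem continuousOn_carriedLoad (s : ℕ) : ContinuousOn (carriedLoad s) (Ioi 0) := fun _ h =>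
  (hasDerivAt_carriedLoad s h).continuousAt.continuousWithinAt

theorem strictMonoOn_carriedLoad {s : ℕ} (hs : 1 ≤ s) : StrictMonoOn (carriedLoad s) (Ioi 0) := by
  refine strictMonoOn_of_deriv_pos (convex_Ioi 0) (continuousOn_carriedLoad s) fun x hx => ?_
  rw [interior_Ioi] at hx
  rw [(hasDerivAt_carriedLoad s hx).deriv]
  exact div_pos (by linarith [(carriedLoad_overflow_le s hx).2 hs]) hx

theorem exists_carriedLoad_eq {s : ℕ} (hs : 1 ≤ s) {c : ℝ} (h0 : 0 < c) (h1 : c < s) :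
    ∃ lam, 0 < lam ∧ carriedLoad s lam = c := by
  have hs0 : (0 : ℝ) < s := by exact_mod_cast hs
  have hsc : 0 < s - c := by linarith
  -- a load that is large enough
  set M := s + s / (s - c) with hM
  have hMs : (s : ℝ) < M := by have : 0 < s / (s - c) := by positivity
                               linarith
  have hM0 : 0 < M := hs0.trans hMs
  have hcM : c ≤ carriedLoad s M := by
    -- `M` satisfies `(M - s)(s - c) = s`; a carried load below `c` would make the product in `hle`
    -- at least `s`, hence larger than the carried load.
    have hle := (carriedLoad_overflow_le s hM0).1
    have hC := carriedLoad_lt hs hM0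
    by_contra hlt
    have hlt := not_le.1 hlt
    have e : (M - s) * (s - c) = s := by rw [hM]; field_simp; ring
    have : (M - s) * (s - c) ≤ (M - carriedLoad s M) * (s - carriedLoad s M) :=
      mul_le_mul (by linarith) (by linarith) (by linarith) (by linarith)
    linarith
  have hcM' : c < M := by linarith
  have hsub : Icc c M ⊆ Ioi 0 := fun x hx => h0.trans_le hx.1
  obtain ⟨lam, hlam, he⟩ := intermediate_value_Icc hcM'.le
    ((continuousOn_carriedLoad s).mono hsub) ⟨(carriedLoad_lt_self s h0).le, hcM⟩
  exact ⟨lam, hsub hlam, he⟩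

/-! ### The overload gap and its unique zero. -/

/-- The sign of this function is opposite to that of the derivative of `carriedLoad ^ 2 / lam`. -/
noncomputable def overloadGap (s : ℕ) (lam : ℝ) : ℝ :=
  2 * (s - carriedLoad s lam) * (lam - carriedLoad s lam) - carriedLoad s lam

theorem cohenGap_eq_overloadGap {s : ℕ} (hs : 1 ≤ s) {lam : ℝ} (h : 0 < lam) :
    (tiltMoment 0 (1 / √s) ((s - lam) / √s))⁻¹ = (lam - carriedLoad s lam) / √s ∧
    cohenGap (1 / √s) ((s - lam) / √s) = -overloadGap s lam / s := by
  have hs0 : (0 : ℝ) < s := by exact_mod_cast hs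
  have hr : 0 < √(s : ℝ) := Real.sqrt_pos.2 hs0
  have hsq : √(s : ℝ) ^ 2 = s := Real.sq_sqrt hs0.le
  have hδ : (s - lam) / √(s : ℝ) < √s := by
    rw [div_lt_iff₀ hr]
    nlinarith
  have h1 : (tiltMoment 0 (1 / √s) ((s - lam) / √s))⁻¹ = (lam - carriedLoad s lam) / √s := by
    rw [inv_tiltMoment_eq hs hδ, div_mul_cancel₀ _ hr.ne', sub_sub_cancel, carriedLoad]
    field_simp
    rw [hsq]
    ring
  refine ⟨h1, ?_⟩
  rw [cohenGap, h1, overloadGap]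
  field_simp
  rw [hsq]
  ring

theorem overloadGap_pos_of_lt {s : ℕ} (hs : 1 ≤ s) {lam : ℝ} (h : (s : ℝ) < lam) :
    0 < overloadGap s lam := by
  have hs0 : (0 : ℝ) < s := by exact_mod_cast hs
  have hr : 0 < √(s : ℝ) := Real.sqrt_pos.2 hs0
  have key := (cohenGap_eq_overloadGap hs (hs0.trans h)).2
  have hδ : (s - lam) / √(s : ℝ) < 0 := div_neg_of_neg_of_pos (by linarith) hr
  have hneg : cohenGap (1 / √s) ((s - lam) / √s) < 0 := by
    rcases hs.eq_or_lt with rfl | hs2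
    · simp only [Nat.cast_one, Real.sqrt_one, div_one] at hδ ⊢
      rw [cohenGap_one (by linarith)]
      exact div_neg_of_neg_of_pos (by nlinarith) (by nlinarith)
    · refine cohenGap_neg (by positivity) ?_ hδ.le
      rw [div_lt_one hr]
      exact Real.lt_sqrt_of_sq_lt (by simpa using hs2)
  rw [key, div_lt_iff₀ hs0] at hneg
  linarith

theorem overloadGap_pos_self {s : ℕ} (hs : 2 ≤ s) : 0 < overloadGap s s := by
  have hs0 : (0 : ℝ) < s := by exact_mod_cast (by omega : 0 < s)
  have hr : 0 < √(s : ℝ) := Real.sqrt_pos.2 hs0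
  have key := (cohenGap_eq_overloadGap (by omega : 1 ≤ s) hs0).2
  have hneg : cohenGap (1 / √s) (((s : ℝ) - s) / √s) < 0 := by
    refine cohenGap_neg (by positivity) ?_ (by simp)
    rw [div_lt_one hr]
    refine Real.lt_sqrt_of_sq_lt ?_
    have : (1 : ℝ) < s := by exact_mod_cast hs
    simpa using this
  rw [key, div_lt_iff₀ hs0] at hneg
  linarith

theorem continuousOn_overloadGap (s : ℕ) : ContinuousOn (overloadGap s) (Ioi 0) := by
  have := continuousOn_carriedLoad s
  unfold overloadGap
  fun_prop

/-- With `T = s - C` and `X = z - C`, the derivative at a zero is `TX(2T + 1 - 2X)/z`. It is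
positive because `z ≤ s`, so that `X ≤ T`; this is where the sign of the gap for overloads is used.
-/
theorem overloadGap_upcrossing {s : ℕ} (hs : 1 ≤ s) {z : ℝ} (hz : 0 < z)
    (h : overloadGap s z = 0) :
    ∀ᶠ x in 𝓝 z, (x < z → overloadGap s x < 0) ∧ (z < x → 0 < overloadGap s x) := by
  have hzs : z ≤ s := by
    by_contra hlt
    linarith [overloadGap_pos_of_lt hs (not_le.1 hlt)]
  have hd := hasDerivAt_carriedLoad s hz
  have hT := carriedLoad_lt hs hz
  have hX := carriedLoad_lt_self s hz
  have hE := (((hd.const_sub (s : ℝ)).const_mul 2).mul ((hasDerivAt_id z).sub hd)).sub hd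
  have hE' : HasDerivAt (overloadGap s) _ z := hE
  simp only [id, Pi.sub_apply] at hE'
  have hpos : 0 < deriv (overloadGap s) z := by
    rw [hE'.deriv]
    simp only [overloadGap] at h
    set c := carriedLoad s z
    have hc : c = 2 * (s - c) * (z - c) := by linarith
    have e : (c - (z - c) * (s - c)) / z = (s - c) * (z - c) / z := by
      congr 1
      linarith
    rw [e]
    have : 2 * -((s - c) * (z - c) / z) * (z - c) + 2 * (s - c) * (1 - (s - c) * (z - c) / z) -
        (s - c) * (z - c) / z =
        (s - c) * (2 * z - 2 * (z - c) * (z - c) - 2 * (s - c) * (z - c) - (z - c)) / z := by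
      field_simp
      ring
    rw [this]
    refine div_pos (mul_pos (by linarith) ?_) hz
    nlinarith [mul_pos (sub_pos.2 hT) (sub_pos.2 hX), mul_nonneg (sub_nonneg.2 hzs) (sub_pos.2 hX).le]
  filter_upwards [eventually_nhdsWithin_sign_eq_of_deriv_pos hpos h] with x hx
  refine ⟨fun hlt => ?_, fun hlt => ?_⟩
  · rwa [sign_neg (sub_neg.2 hlt), sign_eq_neg_one_iff] at hx
  · rwa [sign_pos (sub_pos.2 hlt), sign_eq_one_iff] at hx

theorem exists_overloadGap_zero {s : ℕ} (hs : 1 ≤ s) :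
    ∃ l : ℝ, 0 < l ∧ l ≤ s ∧ overloadGap s l = 0 ∧ (∀ x, 0 < x → x < l → overloadGap s x < 0) ∧
      ∀ x, l < x → 0 < overloadGap s x := by
  have hs0 : (0 : ℝ) < s := by exact_mod_cast hs
  have hs1 : (1 : ℝ) ≤ s := by exact_mod_cast hs
  set q : ℝ := 1 / (4 * s) with hq
  have hq0 : 0 < q := by positivity
  have hqs : q * s = 1 / 4 := by rw [hq]; field_simp
  -- At `q = 1/(4s)` the overflow is at most `q²`, so the product term is at most `2sq² = q/2`,
  -- while the carried load is at least `q - q² ≥ 3q/4`.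
  have hneg : overloadGap s q ≤ 0 := by
    have hB := erlangB_le_self hs hq0
    have hB0 := erlangB_pos s hq0
    have hC := carriedLoad_pos hs hq0
    have e : q - carriedLoad s q = q * erlangB s q := by rw [carriedLoad]; ring
    have : (s - carriedLoad s q) * (q - carriedLoad s q) ≤ s * (q * q) := by
      rw [e]
      exact mul_le_mul (by linarith) (by gcongr) (by positivity) hs0.le
    have h2 : q - q * q ≤ carriedLoad s q := by nlinarith
    have h3 : q ≤ 1 / 4 := by nlinarith
    rw [overloadGap]
    nlinarith
  have hpos : 0 < overloadGap s (s + 1) := overloadGap_pos_of_lt hs (by linarith)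
  have hle : q ≤ s + 1 := by nlinarith
  have hsub : Icc q (s + 1) ⊆ Ioi (0 : ℝ) := fun x hx => hq0.trans_le hx.1
  obtain ⟨l, hl, hl0⟩ := intermediate_value_Icc hle ((continuousOn_overloadGap s).mono hsub)
    ⟨hneg, hpos.le⟩
  have hlpos : 0 < l := hsub hl
  have hup : ∀ x y, 0 < x → x < y → overloadGap s y ≤ 0 → overloadGap s x < 0 := by
    intro x y hx hxy hy
    have hsub' : Icc x y ⊆ Ioi (0 : ℝ) := fun t ht => hx.trans_le ht.1
    exact neg_of_upcrossing ((continuousOn_overloadGap s).mono hsub')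
      (fun z hz hz0 => overloadGap_upcrossing hs (hsub' hz) hz0) hy x ⟨le_rfl, hxy⟩
  refine ⟨l, hlpos, ?_, hl0, fun x hx hxl => hup x l hx hxl hl0.le, fun x hx => ?_⟩
  · by_contra hlt
    linarith [overloadGap_pos_of_lt hs (not_le.1 hlt)]
  · by_contra hle
    linarith [hup l x hlpos hx (not_lt.1 hle)]

/-! ### Cohen's equation parametrized by the load. -/

theorem lossF_eq_carriedLoad {s : ℕ} (hs : 1 ≤ s) (δ : ℝ) :
    lossF s δ * √s = (s - δ * √s) - carriedLoad s (s - δ * √s) := by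
  have hs0 : (0 : ℝ) < s := by exact_mod_cast hs
  have hr : 0 < √(s : ℝ) := Real.sqrt_pos.2 hs0
  have hsq : √(s : ℝ) * √s = s := Real.mul_self_sqrt hs0.le
  have e : √(s : ℝ) * (1 - δ / √s) * √s = s - δ * √s := by
    field_simp
    linarith
  rw [lossF_eq, carriedLoad, mul_right_comm, e]
  ring

theorem isCohenSolution_iff {s : ℕ} (hs : 1 ≤ s) (γ a : ℝ) :
    IsCohenSolution s γ a ↔ 0 ≤ a ∧ carriedLoad s (s - (γ - a) * √s) = s - γ * √s := by
  have hs0 : (0 : ℝ) < s := by exact_mod_cast hs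
  have hr : 0 < √(s : ℝ) := Real.sqrt_pos.2 hs0
  have e := lossF_eq_carriedLoad hs (γ - a)
  refine and_congr_right fun _ => ⟨fun h => ?_, fun h => ?_⟩
  · rw [← h] at e
    linarith
  · refine mul_right_cancel₀ hr.ne' ?_
    rw [e, h]
    ring

/-- The distance `(s - carriedLoad s lam) / √s` from full load. -/
noncomputable def slack (s : ℕ) (lam : ℝ) : ℝ := (s - carriedLoad s lam) / √s

theorem slack_mul_sqrt {s : ℕ} (hs : 1 ≤ s) (lam : ℝ) :
    slack s lam * √s = s - carriedLoad s lam := by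
  have hs0 : (0 : ℝ) < s := by exact_mod_cast hs
  exact div_mul_cancel₀ _ (Real.sqrt_pos.2 hs0).ne'

theorem sqrt_sub_slack {s : ℕ} (lam : ℝ) :
    √s - slack s lam = carriedLoad s lam / √s := by
  rw [slack, sub_div, Real.div_sqrt]
  ring

theorem strictAntiOn_slack {s : ℕ} (hs : 1 ≤ s) : StrictAntiOn (slack s) (Ioi 0) := by
  intro x hx y hy hxy
  have hs0 : (0 : ℝ) < s := by exact_mod_cast hs
  have hr : 0 < √(s : ℝ) := Real.sqrt_pos.2 hs0
  have := strictMonoOn_carriedLoad hs hx hy hxy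
  unfold slack
  gcongr

theorem slack_mem_Ioo {s : ℕ} (hs : 1 ≤ s) {lam : ℝ} (h : 0 < lam) :
    slack s lam ∈ Ioo 0 √(s : ℝ) := by
  have hs0 : (0 : ℝ) < s := by exact_mod_cast hs
  have hr : 0 < √(s : ℝ) := Real.sqrt_pos.2 hs0
  have h1 := carriedLoad_lt hs h
  have h2 := div_pos (carriedLoad_pos hs h) hr
  exact ⟨div_pos (by linarith) hr, by linarith [sqrt_sub_slack (s := s) lam]⟩

theorem exists_slack_eq {s : ℕ} (hs : 1 ≤ s) {γ : ℝ} (hγ : γ ∈ Ioo 0 √(s : ℝ)) :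
    ∃ lam, 0 < lam ∧ slack s lam = γ := by
  have hs0 : (0 : ℝ) < s := by exact_mod_cast hs
  have hr : 0 < √(s : ℝ) := Real.sqrt_pos.2 hs0
  have hsq : √(s : ℝ) * √s = s := Real.mul_self_sqrt hs0.le
  obtain ⟨lam, h, he⟩ := exists_carriedLoad_eq hs (c := s - γ * √s)
    (by nlinarith [hγ.2]) (by nlinarith [mul_pos hγ.1 hr])
  refine ⟨lam, h, ?_⟩
  rw [slack, he]
  field_simp
  ring

/-- Cohen's equation says that the load `C(lam) + a√s` carries `C(lam)`; since `carriedLoad` is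
injective, this load is `lam`. -/
theorem isCohenSolution_slack_iff {s : ℕ} (hs : 1 ≤ s) {lam : ℝ} (h : 0 < lam) (a : ℝ) :
    IsCohenSolution s (slack s lam) a ↔ a = (lam - carriedLoad s lam) / √s := by
  have hs0 : (0 : ℝ) < s := by exact_mod_cast hs
  have hr : 0 < √(s : ℝ) := Real.sqrt_pos.2 hs0
  have hC := carriedLoad_pos hs h
  have e : (s : ℝ) - (slack s lam - a) * √s = carriedLoad s lam + a * √s := by
    rw [sub_mul, slack_mul_sqrt hs]; ring
  rw [isCohenSolution_iff hs, e, slack_mul_sqrt hs, sub_sub_cancel, eq_div_iff hr.ne']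
  constructor
  · rintro ⟨ha, hc⟩
    have := (strictMonoOn_carriedLoad hs).injOn
      (by have := mul_nonneg ha hr.le
          exact mem_Ioi.2 (by linarith)) (mem_Ioi.2 h) hc
    linarith
  · intro ha
    refine ⟨?_, by rw [ha, add_sub_cancel]⟩
    by_contra hneg
    nlinarith [carriedLoad_lt_self s h, not_le.1 hneg]

theorem existsUnique_isCohenSolution {s : ℕ} (hs : 1 ≤ s) {γ : ℝ} (hγ : γ ∈ Ioo 0 √(s : ℝ)) :
    ∃! a, IsCohenSolution s γ a := by
  obtain ⟨lam, h, rfl⟩ := exists_slack_eq hs hγ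
  exact ⟨_, (isCohenSolution_slack_iff hs h _).2 rfl, fun a ha =>
    (isCohenSolution_slack_iff hs h a).1 ha⟩

theorem cohenSol_slack {s : ℕ} (hs : 1 ≤ s) {lam : ℝ} (h : 0 < lam) :
    cohenSol s (slack s lam) = (lam - carriedLoad s lam) / √s :=
  (isCohenSolution_slack_iff hs h _).1
    (Classical.epsilon_spec ⟨_, (isCohenSolution_slack_iff hs h _).2 rfl⟩)

theorem carriedL_slack {s : ℕ} (hs : 1 ≤ s) {lam : ℝ} (h : 0 < lam) :
    carriedL s (slack s lam) = carriedLoad s lam ^ 2 / lam / √s := by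
  have hs0 : (0 : ℝ) < s := by exact_mod_cast hs
  have hr : 0 < √(s : ℝ) := Real.sqrt_pos.2 hs0
  rw [carriedL, cohenSol_slack hs h, sqrt_sub_slack, ← add_div, add_sub_cancel]
  field_simp

theorem carriedL_mem_Ioo {s : ℕ} (hs : 1 ≤ s) {γ : ℝ} (hγ : γ ∈ Ioo 0 √(s : ℝ)) :
    carriedL s γ ∈ Ioo 0 (√s - γ) := by
  obtain ⟨lam, h, rfl⟩ := exists_slack_eq hs hγ
  have hs0 : (0 : ℝ) < s := by exact_mod_cast hs
  have hr : 0 < √(s : ℝ) := Real.sqrt_pos.2 hs0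
  have hC := carriedLoad_pos hs h
  rw [carriedL_slack hs h, sqrt_sub_slack]
  refine ⟨by positivity, ?_⟩
  gcongr
  rw [div_lt_iff₀ h]
  nlinarith [carriedLoad_lt_self s h]

/-! ### Asymptotics at both ends. -/

theorem abs_carriedL_sub_le {s : ℕ} (hs : 1 ≤ s) {γ : ℝ} (hγ : γ ∈ Ioo 0 √(s : ℝ)) :
    |carriedL s γ - γ * s| ≤ γ * s * (2 * (γ * √s)) := by
  obtain ⟨lam, h, rfl⟩ := exists_slack_eq hs hγ
  have hs0 : (0 : ℝ) < s := by exact_mod_cast hs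
  have hs1 : (1 : ℝ) ≤ s := by exact_mod_cast hs
  have hr : 0 < √(s : ℝ) := Real.sqrt_pos.2 hs0
  have hC := carriedLoad_pos hs h
  have hCs := carriedLoad_lt hs h
  have hCl := carriedLoad_lt_self s h
  have b1 := carriedLoad_mul_le hs h
  have b2 := (carriedLoad_overflow_le s h).1
  rw [carriedL_slack hs h, slack_mul_sqrt hs, slack]
  set c := carriedLoad s lam
  -- Here `T = γ√s` and `p = 1 - B`. The two carried-load estimates give `T - T² ≤ p ≤ T`, and `L_s
  -- = (s - T)p/√s` is compared with `Ts/√s`.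
  obtain ⟨T, hT⟩ : ∃ T, T = s - c := ⟨_, rfl⟩
  obtain ⟨p, hp⟩ : ∃ p, p = c / lam := ⟨_, rfl⟩
  have hT0 : 0 < T := by rw [hT]; linarith
  have hp0 : 0 < p := by rw [hp]; positivity
  have hcp : c = p * lam := by rw [hp]; field_simp
  have hpT : p ≤ T := by rw [hp, hT, div_le_iff₀ h]; exact b1
  have hpT' : T - T ^ 2 ≤ p := by
    have : (1 - p) * T ≤ p := by
      have e : (lam - c) * (s - c) = lam * ((1 - p) * T) := by rw [← hT, hcp]; ring
      rw [e] at b2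
      refine le_of_mul_le_mul_left ?_ h
      linarith
    nlinarith
  have e1 : c ^ 2 / lam / √s - (s - c) / √s * s = (c * p - T * s) / √s := by
    rw [hp, hT]; field_simp
  have e2 : (s - c) / √s * s * (2 * (s - c)) = 2 * s * T ^ 2 / √s := by
    rw [hT]; field_simp
  rw [e1, e2, abs_div, abs_of_pos hr]
  gcongr
  have hcT : c = s - T := by linarith
  rw [abs_le]
  constructor
  · have : (s - T) * (T - T ^ 2) ≤ c * p := by
      rw [← hcT]
      exact mul_le_mul_of_nonneg_left hpT' hC.le
    nlinarith [pow_pos hT0 3, pow_pos hT0 2]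
  · have : c * p ≤ s * T := mul_le_mul hCs.le hpT hp0.le hs0.le
    nlinarith [pow_pos hT0 2]

theorem erlangB_le_pow_div {s : ℕ} {lam : ℝ} (h : 0 < lam) :
    erlangB s lam ≤ lam ^ s / s.factorial := by
  unfold erlangB
  refine div_le_self (by positivity) ?_
  rw [Finset.sum_range_succ', pow_zero, Nat.factorial_zero, Nat.cast_one, div_one]
  have : 0 ≤ ∑ k ∈ Finset.range s, lam ^ (k + 1) / ((k + 1).factorial : ℝ) :=
    Finset.sum_nonneg fun k _ => by positivity
  linarith

theorem sqrt_mul_pow_le_factorial {s : ℕ} (hs : 1 ≤ s) :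
    √s * (s : ℝ) ^ s ≤ s.factorial * Real.exp s := by
  have hs0 : (0 : ℝ) < s := by exact_mod_cast hs
  have h := Stirling.le_factorial_stirling s
  have e : Real.exp (s : ℝ) = Real.exp 1 ^ s := by rw [← Real.exp_nat_mul, mul_one]
  rw [div_pow, mul_div_assoc', div_le_iff₀ (by positivity), ← e] at h
  refine le_trans ?_ h
  gcongr
  nlinarith [Real.pi_gt_three]

/-- The relative error is exactly `B ≤ lam^s/s!`. For `lam < 1/(2s)` Bernoulli's inequality gives
`(1 - B)^s ≥ 1/2`, so `lam^s` may be replaced by twice the `s`-th power of the carried load;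
Stirling's bound handles `s!`. -/
theorem eventually_abs_carriedL_sub_le {s : ℕ} (hs : 1 ≤ s) :
    ∀ᶠ γ in 𝓝[<] √(s : ℝ), |carriedL s γ - (√s - γ)| ≤
      (√s - γ) * (2 * (Real.exp s / √s * (1 - γ / √s) ^ s)) := by
  have hs0 : (0 : ℝ) < s := by exact_mod_cast hs
  have hr : 0 < √(s : ℝ) := Real.sqrt_pos.2 hs0
  have hsq : √(s : ℝ) * √s = s := Real.mul_self_sqrt hs0.le
  have hq0 : (0 : ℝ) < 1 / (2 * s) := by positivity
  have hm := slack_mem_Ioo hs hq0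
  filter_upwards [Ioo_mem_nhdsLT hm.2] with γ hγ
  obtain ⟨lam, h, rfl⟩ := exists_slack_eq hs ⟨hm.1.trans hγ.1, hγ.2⟩
  have hlam : lam < 1 / (2 * s) := ((strictAntiOn_slack hs).lt_iff_gt hq0 h).1 hγ.1
  have hC := carriedLoad_pos hs h
  have hB0 := erlangB_pos s h
  have hBs : s * erlangB s lam ≤ 1 / 2 := by
    have h1 := erlangB_le_self hs h
    rw [lt_div_iff₀ (by positivity)] at hlam
    nlinarith
  have hB1 : erlangB s lam ≤ 1 / 2 := by
    have : (1 : ℝ) ≤ s := by exact_mod_cast hs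
    nlinarith
  have hbern : 1 / 2 ≤ (1 - erlangB s lam) ^ s := by
    have := one_add_mul_le_pow (a := -erlangB s lam) (by linarith) s
    rw [← sub_eq_add_neg] at this
    linarith
  have hpow : lam ^ s ≤ 2 * carriedLoad s lam ^ s := by
    rw [carriedLoad, mul_pow]
    nlinarith [pow_pos h s]
  have hB : erlangB s lam ≤ 2 * (Real.exp s / √s * (carriedLoad s lam / s) ^ s) := by
    refine (erlangB_le_pow_div h).trans ?_
    have hf := sqrt_mul_pow_le_factorial hs
    rw [div_pow, div_mul_div_comm, mul_div_assoc', div_le_div_iff₀ (by positivity) (by positivity)]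
    calc lam ^ s * (√s * (s : ℝ) ^ s)
        ≤ (2 * carriedLoad s lam ^ s) * (s.factorial * Real.exp s) := by gcongr
      _ = _ := by ring
  have e : 1 - slack s lam / √s = carriedLoad s lam / s := by
    rw [slack, div_div, hsq]
    field_simp
    ring
  rw [carriedL_slack hs h, sqrt_sub_slack, e]
  have e2 : carriedLoad s lam ^ 2 / lam / √s - carriedLoad s lam / √s =
      -(carriedLoad s lam / √s * erlangB s lam) := by
    have : carriedLoad s lam ^ 2 / lam = carriedLoad s lam * (1 - erlangB s lam) := by
      rw [sq, carriedLoad]; field_simp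
    rw [this]
    ring
  rw [e2, abs_neg, abs_of_nonneg (by positivity)]
  gcongr

/-! ### Unimodality and the maximum value. -/

theorem hasDerivAt_carriedLoad_sq_div (s : ℕ) {lam : ℝ} (h : 0 < lam) :
    HasDerivAt (fun l => carriedLoad s l ^ 2 / l)
      (-(carriedLoad s lam * overloadGap s lam) / lam ^ 2) lam := by
  refine (((hasDerivAt_carriedLoad s h).pow 2).div (hasDerivAt_id lam) h.ne').congr_deriv ?_
  simp only [id, overloadGap, Pi.pow_apply]
  field_simp
  ring

theorem carriedLoad_sq_div_strictMonoOn {s : ℕ} (hs : 1 ≤ s) {l : ℝ}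
    (hl : ∀ x, 0 < x → x < l → overloadGap s x < 0) :
    StrictMonoOn (fun x => carriedLoad s x ^ 2 / x) (Ioc 0 l) := by
  refine strictMonoOn_of_deriv_pos (convex_Ioc 0 l) (fun x hx =>
    (hasDerivAt_carriedLoad_sq_div s hx.1).continuousAt.continuousWithinAt) fun x hx => ?_
  rw [interior_Ioc] at hx
  rw [(hasDerivAt_carriedLoad_sq_div s hx.1).deriv]
  have h1 := carriedLoad_pos hs hx.1
  have h2 := hl x hx.1 hx.2
  have := hx.1
  exact div_pos (by nlinarith) (by positivity)

theorem carriedLoad_sq_div_strictAntiOn {s : ℕ} (hs : 1 ≤ s) {l : ℝ} (hl0 : 0 < l)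
    (hl : ∀ x, l < x → 0 < overloadGap s x) :
    StrictAntiOn (fun x => carriedLoad s x ^ 2 / x) (Ici l) := by
  refine strictAntiOn_of_deriv_neg (convex_Ici l) (fun x hx =>
    (hasDerivAt_carriedLoad_sq_div s
      (hl0.trans_le hx)).continuousAt.continuousWithinAt) fun x hx => ?_
  rw [interior_Ici] at hx
  have hx0 : 0 < x := hl0.trans hx
  rw [(hasDerivAt_carriedLoad_sq_div s hx0).deriv]
  have h1 := carriedLoad_pos hs hx0
  have h2 := hl x hx
  exact div_neg_of_neg_of_pos (by nlinarith) (by positivity)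

/-- The load at which the derivative of `carriedLoad ^ 2 / lam` vanishes. -/
noncomputable def optLoad (s : ℕ) : ℝ :=
  if hs : 1 ≤ s then (exists_overloadGap_zero hs).choose else 0

theorem optLoad_spec {s : ℕ} (hs : 1 ≤ s) :
    0 < optLoad s ∧ optLoad s ≤ s ∧ overloadGap s (optLoad s) = 0 ∧
      (∀ x, 0 < x → x < optLoad s → overloadGap s x < 0) ∧
      ∀ x, optLoad s < x → 0 < overloadGap s x := by
  rw [optLoad, dif_pos hs]
  exact (exists_overloadGap_zero hs).choose_spec

theorem optLoad_lt_iff {s : ℕ} (hs : 1 ≤ s) {x : ℝ} (hx : 0 < x) :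
    optLoad s < x ↔ 0 < overloadGap s x := by
  obtain ⟨-, -, h0, h1, h2⟩ := optLoad_spec hs
  refine ⟨h2 x, fun h => ?_⟩
  by_contra hle
  rcases (not_lt.1 hle).eq_or_lt with rfl | hlt
  · exact h.ne' h0
  · exact (h1 x hx hlt).not_gt h

theorem lt_optLoad_iff {s : ℕ} (hs : 1 ≤ s) {x : ℝ} (hx : 0 < x) :
    x < optLoad s ↔ overloadGap s x < 0 := by
  obtain ⟨-, -, h0, h1, h2⟩ := optLoad_spec hs
  refine ⟨h1 x hx, fun h => ?_⟩
  by_contra hle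
  rcases (not_lt.1 hle).eq_or_lt with heq | hlt
  · rw [← heq] at h; exact h.ne h0
  · exact (h2 x hlt).not_gt h

/-- The optimal slack. -/
noncomputable def optSlack (s : ℕ) : ℝ := slack s (optLoad s)

theorem overloadGap_eq_zero_iff {s : ℕ} (hs : 1 ≤ s) {lam : ℝ} (h : 0 < lam) :
    overloadGap s lam = 0 ↔ lam = optLoad s := by
  constructor
  · intro h0
    rcases lt_trichotomy lam (optLoad s) with hlt | heq | hlt
    · exact absurd h0 ((lt_optLoad_iff hs h).1 hlt).ne
    · exact heq
    · exact absurd h0 ((optLoad_lt_iff hs h).1 hlt).ne'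
  · rintro rfl
    exact (optLoad_spec hs).2.2.1

theorem cohenSol_slack_eq_iff {s : ℕ} (hs : 1 ≤ s) {lam : ℝ} (h : 0 < lam) :
    slack s lam * cohenSol s (slack s lam) = 1 / 2 * (1 - slack s lam / √s) ↔
      overloadGap s lam = 0 := by
  have hs0 : (0 : ℝ) < s := by exact_mod_cast hs
  have hr : 0 < √(s : ℝ) := Real.sqrt_pos.2 hs0
  have hsq : √(s : ℝ) * √s = s := Real.mul_self_sqrt hs0.le
  have e1 : slack s lam * cohenSol s (slack s lam) =
      (s - carriedLoad s lam) * (lam - carriedLoad s lam) / s := by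
    rw [cohenSol_slack hs h, slack, div_mul_div_comm, hsq]
  have e2 : 1 / 2 * (1 - slack s lam / √s) = carriedLoad s lam / 2 / s := by
    rw [slack, div_div, hsq]
    field_simp
    ring
  rw [e1, e2, div_left_inj' hs0.ne', overloadGap]
  constructor <;> intro h <;> linarith

theorem optSlack_mem {s : ℕ} (hs : 1 ≤ s) : optSlack s ∈ Ioo 0 √(s : ℝ) :=
  slack_mem_Ioo hs (optLoad_spec hs).1

theorem root_iff_optSlack {s : ℕ} (hs : 1 ≤ s) {γ : ℝ} (hγ : γ ∈ Ioo 0 √(s : ℝ)) :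
    γ * cohenSol s γ = 1 / 2 * (1 - γ / √s) ↔ γ = optSlack s := by
  obtain ⟨lam, h, rfl⟩ := exists_slack_eq hs hγ
  rw [cohenSol_slack_eq_iff hs h, overloadGap_eq_zero_iff hs h, optSlack,
    (strictAntiOn_slack hs).injOn.eq_iff h (optLoad_spec hs).1]

theorem carriedL_strictMonoOn {s : ℕ} (hs : 1 ≤ s) :
    StrictMonoOn (carriedL s) (Ioc 0 (optSlack s)) := by
  have hs0 : (0 : ℝ) < s := by exact_mod_cast hs
  have hr : 0 < √(s : ℝ) := Real.sqrt_pos.2 hs0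
  obtain ⟨hl0, -, -, -, h2⟩ := optLoad_spec hs
  have hm := optSlack_mem hs
  have hanti := strictAntiOn_slack hs
  intro x hx y hy hxy
  obtain ⟨a, ha, rfl⟩ := exists_slack_eq hs ⟨hx.1, hx.2.trans_lt hm.2⟩
  obtain ⟨b, hb, rfl⟩ := exists_slack_eq hs ⟨hy.1, hy.2.trans_lt hm.2⟩
  have hba : b < a := (hanti.lt_iff_gt ha hb).1 hxy
  have hlb : optLoad s ≤ b := (hanti.le_iff_ge hb hl0).1 hy.2
  rw [carriedL_slack hs ha, carriedL_slack hs hb]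
  exact div_lt_div_of_pos_right
    (carriedLoad_sq_div_strictAntiOn hs hl0 h2 hlb (hlb.trans hba.le) hba) hr

theorem carriedL_strictAntiOn {s : ℕ} (hs : 1 ≤ s) :
    StrictAntiOn (carriedL s) (Ico (optSlack s) √s) := by
  have hs0 : (0 : ℝ) < s := by exact_mod_cast hs
  have hr : 0 < √(s : ℝ) := Real.sqrt_pos.2 hs0
  obtain ⟨hl0, -, -, h1, -⟩ := optLoad_spec hs
  have hm := optSlack_mem hs
  have hanti := strictAntiOn_slack hs
  intro x hx y hy hxy
  obtain ⟨a, ha, rfl⟩ := exists_slack_eq hs ⟨hm.1.trans_le hx.1, hx.2⟩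
  obtain ⟨b, hb, rfl⟩ := exists_slack_eq hs ⟨hm.1.trans_le hy.1, hy.2⟩
  have hba : b < a := (hanti.lt_iff_gt ha hb).1 hxy
  have hla : a ≤ optLoad s := (hanti.le_iff_ge hl0 ha).1 hx.1
  rw [carriedL_slack hs ha, carriedL_slack hs hb]
  exact div_lt_div_of_pos_right
    (carriedLoad_sq_div_strictMonoOn hs h1 ⟨hb, hba.le.trans hla⟩ ⟨ha, hla⟩ hba) hr

theorem carriedL_lt_optSlack {s : ℕ} (hs : 1 ≤ s) {γ : ℝ} (hγ : γ ∈ Ioo 0 √(s : ℝ))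
    (hne : γ ≠ optSlack s) : carriedL s γ < carriedL s (optSlack s) := by
  have hm := optSlack_mem hs
  rcases lt_or_gt_of_ne hne with h | h
  · exact carriedL_strictMonoOn hs ⟨hγ.1, h.le⟩ ⟨hm.1, le_rfl⟩ h
  · exact carriedL_strictAntiOn hs ⟨le_rfl, hm.2⟩ ⟨h.le, hγ.2⟩ h

theorem carriedL_optSlack {s : ℕ} (hs : 1 ≤ s) :
    carriedL s (optSlack s) =
      optSlack s / (optSlack s + 1 / (2 * √s)) * (√s - optSlack s) := by
  have hs0 : (0 : ℝ) < s := by exact_mod_cast hs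
  have hr : 0 < √(s : ℝ) := Real.sqrt_pos.2 hs0
  have hm := optSlack_mem hs
  have h := (root_iff_optSlack hs hm).2 rfl
  have hγ := hm.1
  have hg : 0 < √(s : ℝ) - optSlack s := by linarith [hm.2]
  have ha : cohenSol s (optSlack s) = (√s - optSlack s) / (2 * optSlack s * √s) := by
    field_simp at h ⊢
    linarith
  rw [carriedL, ha]
  field_simp

/-! ### Lower bounds for the optimal slack. -/

theorem lossF_zero_lt_optSlack {s : ℕ} (hs : 2 ≤ s) : lossF s 0 < optSlack s := by
  have hs1 : 1 ≤ s := by omega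
  have hs0 : (0 : ℝ) < s := by exact_mod_cast hs1
  have hr : 0 < √(s : ℝ) := Real.sqrt_pos.2 hs0
  have e : lossF s 0 = slack s s := by
    have := lossF_eq_carriedLoad hs1 0
    rw [zero_mul, sub_zero] at this
    rw [slack, eq_div_iff hr.ne', this]
  rw [e]
  exact strictAntiOn_slack hs1 (optLoad_spec hs1).1 (mem_Ioi.2 hs0)
    ((optLoad_lt_iff hs1 hs0).2 (overloadGap_pos_self hs))

theorem lt_lossF_zero {s : ℕ} (hs : 2 ≤ s) :
    √(1 / 2 + 1 / (16 * (s : ℝ))) - 1 / (4 * √s) < lossF s 0 := by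
  have hs1 : 1 ≤ s := by omega
  have hs0 : (0 : ℝ) < s := by exact_mod_cast hs1
  have hr : 0 < √(s : ℝ) := Real.sqrt_pos.2 hs0
  have hsq : √(s : ℝ) ^ 2 = s := Real.sq_sqrt hs0.le
  have e := lossF_eq_carriedLoad hs1 0
  rw [zero_mul, sub_zero] at e
  have hgap := overloadGap_pos_self hs
  have hC := carriedLoad_lt hs1 hs0
  rw [overloadGap, ← e] at hgap
  have hb : 0 < lossF s 0 := by
    by_contra hle
    nlinarith [not_lt.1 hle]
  have hc : carriedLoad s s = s - lossF s 0 * √s := by linarith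
  rw [hc] at hgap
  -- This is positivity of the overload gap at load `s`, divided by `s`; completing the square gives
  -- the claim.
  have hmain : 1 < 2 * lossF s 0 ^ 2 + lossF s 0 / √s := by
    have h2 : 2 * lossF s 0 ^ 2 + lossF s 0 / √s - 1 =
        (2 * (lossF s 0 * √s) * (lossF s 0 * √s) - (s - lossF s 0 * √s)) / s := by
      have e5 : lossF s 0 / √s * s = lossF s 0 * √s := by
        rw [div_mul_eq_mul_div, div_eq_iff hr.ne', mul_assoc, Real.mul_self_sqrt hs0.le]
      rw [eq_div_iff hs0.ne']
      linear_combination e5 - 2 * lossF s 0 ^ 2 * hsq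
    have := div_pos hgap hs0
    linarith
  rw [sub_lt_iff_lt_add, Real.sqrt_lt' (by positivity)]
  have e3 : (1 / (4 * √(s : ℝ))) ^ 2 = 1 / (16 * s) := by
    rw [div_pow, mul_pow, hsq]; norm_num
  have e4 : (lossF s 0 + 1 / (4 * √s)) ^ 2 =
      lossF s 0 ^ 2 + lossF s 0 / √s / 2 + 1 / (16 * s) := by
    rw [add_sq, e3]; ring
  rw [e4]
  linarith

/-! ### Monotonicity in `s`. -/

/-- Comparison of the reciprocal mass with its value at the root: the case of a larger one. -/
theorem lt_optSlack_of_lt_inv {s : ℕ} (hs : 1 ≤ s) {γ a : ℝ} (hγ : 0 < γ) (ha : 0 < a)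
    (haγ : a = 1 / (2 * γ) - 1 / √s / 2) (h : a < (tiltMoment 0 (1 / √s) (γ - a))⁻¹) :
    γ < optSlack s := by
  have hs0 : (0 : ℝ) < s := by exact_mod_cast hs
  have hr : 0 < √(s : ℝ) := Real.sqrt_pos.2 hs0
  have hone : γ * (1 / √s + 2 * a) = 1 := by rw [haγ]; field_simp; ring
  have hlam : (s : ℝ) - (γ - a) * √s = s * (a * (2 * γ + 1 / √s)) := by
    have e1 : (s : ℝ) * (1 / √s) = √s := by rw [mul_one_div, Real.div_sqrt]
    have e2 : γ * (√s + 2 * a * s) = s := by linear_combination s * hone - γ * e1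
    linear_combination -e2 - a * e1
  have hl0 : 0 < (s : ℝ) - (γ - a) * √s := by rw [hlam]; positivity
  have hδ : ((s : ℝ) - (s - (γ - a) * √s)) / √s = γ - a := by rw [sub_sub_cancel]; field_simp
  obtain ⟨hA, hG⟩ := cohenGap_eq_overloadGap hs hl0
  rw [hδ] at hA hG
  -- `hone` is the root equation for `(γ, a)`. A larger reciprocal mass makes the gap negative, so
  -- the optimal load is smaller than the load at `δ = γ - a`, whose slack `γ - a + 1/V` already
  -- exceeds `γ`.
  have hgap : cohenGap (1 / √s) (γ - a) < 0 := by
    rw [cohenGap]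
    nlinarith [mul_lt_mul'' (by linarith : γ < γ - a + (tiltMoment 0 (1 / √s) (γ - a))⁻¹)
      (by linarith : 1 / √s + 2 * a < 1 / √s + 2 * (tiltMoment 0 (1 / √s) (γ - a))⁻¹)
      hγ.le (by positivity)]
  rw [hG, div_lt_iff₀ hs0] at hgap
  have hlt := (optLoad_lt_iff hs hl0).2 (by linarith)
  have hsl := strictAntiOn_slack hs (mem_Ioi.2 (optLoad_spec hs).1) (mem_Ioi.2 hl0) hlt
  have e : slack s (s - (γ - a) * √s) =
      ((s : ℝ) - (s - (γ - a) * √s)) / √s + (tiltMoment 0 (1 / √s) (γ - a))⁻¹ := by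
    rw [hA, slack]; ring
  rw [hδ] at e
  have : slack s (s - (γ - a) * √s) < optSlack s := hsl
  linarith

/-- Comparison of the reciprocal mass with its value at the root: the case of a smaller one. -/
theorem optSlack_lt_of_inv_lt {s : ℕ} (hs : 1 ≤ s) {γ a : ℝ} (hγ : 0 < γ) (ha : 0 < a)
    (haγ : a = 1 / (2 * γ) - 1 / √s / 2) (h : (tiltMoment 0 (1 / √s) (γ - a))⁻¹ < a) :
    optSlack s < γ := by
  have hs0 : (0 : ℝ) < s := by exact_mod_cast hs
  have hr : 0 < √(s : ℝ) := Real.sqrt_pos.2 hs0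
  have hone : γ * (1 / √s + 2 * a) = 1 := by rw [haγ]; field_simp; ring
  have hlam : (s : ℝ) - (γ - a) * √s = s * (a * (2 * γ + 1 / √s)) := by
    have e1 : (s : ℝ) * (1 / √s) = √s := by rw [mul_one_div, Real.div_sqrt]
    have e2 : γ * (√s + 2 * a * s) = s := by linear_combination s * hone - γ * e1
    linear_combination -e2 - a * e1
  have hl0 : 0 < (s : ℝ) - (γ - a) * √s := by rw [hlam]; positivity
  have hδ : ((s : ℝ) - (s - (γ - a) * √s)) / √s = γ - a := by rw [sub_sub_cancel]; field_simp
  obtain ⟨hA, hG⟩ := cohenGap_eq_overloadGap hs hl0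
  rw [hδ] at hA hG
  have hA0 : 0 < (tiltMoment 0 (1 / √s) (γ - a))⁻¹ := by
    rw [hA]
    exact div_pos (by linarith [carriedLoad_lt_self s hl0]) hr
  have hgap : 0 < cohenGap (1 / √s) (γ - a) := by
    rw [cohenGap]
    have h1 := mul_lt_mul_of_pos_right
      (by linarith : γ - a + (tiltMoment 0 (1 / √s) (γ - a))⁻¹ < γ)
      (by positivity : 0 < 1 / √s + 2 * (tiltMoment 0 (1 / √s) (γ - a))⁻¹)
    have h2 := mul_lt_mul_of_pos_left
      (by linarith : 1 / √s + 2 * (tiltMoment 0 (1 / √s) (γ - a))⁻¹ < 1 / √s + 2 * a) hγ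
    linarith
  rw [hG, lt_div_iff₀ hs0] at hgap
  have hlt := (lt_optLoad_iff hs hl0).2 (by linarith)
  have hsl := strictAntiOn_slack hs (mem_Ioi.2 hl0) (mem_Ioi.2 (optLoad_spec hs).1) hlt
  have e : slack s (s - (γ - a) * √s) =
      ((s : ℝ) - (s - (γ - a) * √s)) / √s + (tiltMoment 0 (1 / √s) (γ - a))⁻¹ := by
    rw [hA, slack]; ring
  rw [hδ] at e
  have : optSlack s < slack s (s - (γ - a) * √s) := hsl
  linarith

/-- Fix the optimal `γ` for `s`. The root equation asks for `a = 1/(2γ) - ε/2`, so `δ = γ - a` moves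
along a line of slope `1/2` in `ε`. The gap vanishes at `1/√s`, hence is negative at `1/√t`; there
the reciprocal mass exceeds the required `a`. -/
theorem optSlack_lt_optSlack {s t : ℕ} (hs : 1 ≤ s) (hst : s < t) : optSlack s < optSlack t := by
  have ht : 1 ≤ t := hs.trans hst.le
  have hs0 : (0 : ℝ) < s := by exact_mod_cast hs
  have hr : 0 < √(s : ℝ) := Real.sqrt_pos.2 hs0
  have ht0 : (0 : ℝ) < t := by exact_mod_cast ht
  have hrt : 0 < √(t : ℝ) := Real.sqrt_pos.2 ht0
  have hsqrt : √(s : ℝ) < √t := Real.sqrt_lt_sqrt hs0.le (by exact_mod_cast hst)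
  obtain ⟨hl0, hls, hgap, -, -⟩ := optLoad_spec hs
  obtain ⟨hA, hG⟩ := cohenGap_eq_overloadGap hs hl0
  rw [hgap, neg_zero, zero_div] at hG
  obtain ⟨γ, hγdef⟩ : ∃ γ, γ = optSlack s := ⟨_, rfl⟩
  obtain ⟨a, hadef⟩ : ∃ a, a = (optLoad s - carriedLoad s (optLoad s)) / √s := ⟨_, rfl⟩
  have hγ : 0 < γ := by rw [hγdef]; exact (optSlack_mem hs).1
  have ha : 0 < a := by
    rw [hadef]; exact div_pos (by linarith [carriedLoad_lt_self s hl0]) hr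
  have hδ : (s - optLoad s) / √(s : ℝ) = γ - a := by
    rw [hγdef, hadef, optSlack, slack]; ring
  rw [hδ] at hA hG
  rw [← hadef] at hA
  have hone : γ * (1 / √s + 2 * a) = 1 := by
    rw [cohenGap, hA, sub_add_cancel] at hG
    linarith
  have haγ : a = 1 / (2 * γ) - 1 / √s / 2 := by
    field_simp at hone ⊢
    linarith
  have hδ0 : 0 ≤ γ - a := by
    rw [← hδ]; exact div_nonneg (by linarith) hr.le
  have hx : 1 / √(t : ℝ) < 1 / √s := one_div_lt_one_div_of_lt hr hsqrt
  have hx1 : 1 / √(s : ℝ) ≤ 1 := by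
    rw [div_le_one hr]
    exact Real.one_le_sqrt.2 (by exact_mod_cast hs)
  have e1 : γ - 1 / (2 * γ) + 1 / 2 * (1 / √s) = γ - a := by rw [haγ]; ring
  obtain ⟨b, hb⟩ : ∃ b, b = 1 / (2 * γ) - 1 / √t / 2 := ⟨_, rfl⟩
  have hb0 : 0 < b := by linarith
  have e2 : γ - 1 / (2 * γ) + 1 / 2 * (1 / √t) = γ - b := by rw [hb]; ring
  have hinv : γ * (1 / (2 * γ)) = 1 / 2 := by field_simp
  have hpath := cohenGap_path_neg (δ₀ := γ - 1 / (2 * γ)) (x₀ := 1 / √t) (x₁ := 1 / √s)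
    (by positivity) hx hx1
    (fun τ hτ => by
      have hτ0 : 0 < τ := (by positivity : 0 < 1 / √(t : ℝ)).trans_le hτ.1
      have haτ : 0 < 1 / (2 * γ) - τ / 2 := by linarith [hτ.2]
      have : 1 - (γ - 1 / (2 * γ) + 1 / 2 * τ) * τ = (1 / (2 * γ) - τ / 2) * (2 * γ + τ) := by
        linear_combination -2 * hinv
      have : 0 < (1 / (2 * γ) - τ / 2) * (2 * γ + τ) := by positivity
      linarith)
    (by rw [e1]; exact hδ0) (by rw [e1, hG])
  rw [e2] at hpath
  rw [← hγdef]
  refine lt_optSlack_of_lt_inv ht hγ hb0 hb ?_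
  have hone' : γ * (1 / √t + 2 * b) = 1 := by rw [hb]; linear_combination 2 * hinv
  have hδt : (γ - b) * (1 / √t) < 1 := by
    have : 1 - (γ - b) * (1 / √t) = b * (2 * γ + 1 / √t) := by linear_combination -hone'
    have : 0 < b * (2 * γ + 1 / √t) := by positivity
    linarith
  have hB := inv_pos.2 (tiltMoment_pos 0 (by positivity : 0 ≤ 1 / √(t : ℝ)) hδt)
  rw [cohenGap] at hpath
  by_contra hle
  have hle := not_lt.1 hle
  have h1 := mul_le_mul_of_nonneg_right
    (by linarith : γ - b + (tiltMoment 0 (1 / √t) (γ - b))⁻¹ ≤ γ)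
    (by positivity : 0 ≤ 1 / √(t : ℝ) + 2 * (tiltMoment 0 (1 / √t) (γ - b))⁻¹)
  have h2 := mul_le_mul_of_nonneg_left
    (by linarith : 1 / √(t : ℝ) + 2 * (tiltMoment 0 (1 / √t) (γ - b))⁻¹ ≤ 1 / √t + 2 * b) hγ.le
  linarith

/-! ### The limit `s → ∞`. -/

theorem tendsto_one_div_sqrt : Tendsto (fun s : ℕ => 1 / √(s : ℝ)) atTop (𝓝 0) := by
  simp only [one_div]
  exact tendsto_inv_atTop_zero.comp (Real.tendsto_sqrt_atTop.comp tendsto_natCast_atTop_atTop)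

theorem tendsto_inv_tiltMoment (γ : ℝ) :
    Tendsto (fun s : ℕ => (tiltMoment 0 (1 / √s) (γ - (1 / (2 * γ) - 1 / √s / 2)))⁻¹) atTop
      (𝓝 (tiltMoment 0 0 (γ - 1 / (2 * γ)))⁻¹) := by
  refine (tendsto_tiltMoment_zero le_rfl (by simp) tendsto_one_div_sqrt ?_
    (.of_forall fun s => by positivity)).inv₀ (tiltMoment_pos 0 le_rfl (by simp)).ne'
  have h := (tendsto_one_div_sqrt.div_const 2).const_sub (1 / (2 * γ))
  have h' := h.const_sub γ
  simpa using h'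

theorem tendsto_root_value (γ : ℝ) :
    Tendsto (fun s : ℕ => 1 / (2 * γ) - 1 / √(s : ℝ) / 2) atTop (𝓝 (1 / (2 * γ))) := by
  have h := (tendsto_one_div_sqrt.div_const 2).const_sub (1 / (2 * γ))
  simpa using h

theorem eventually_lt_optSlack {γ : ℝ} (hγ : 0 < γ)
    (h : tiltMoment 0 0 (γ - 1 / (2 * γ)) < 2 * γ) : ∀ᶠ s in atTop, γ < optSlack s := by
  have hlt : 1 / (2 * γ) < (tiltMoment 0 0 (γ - 1 / (2 * γ)))⁻¹ := by
    simpa only [one_div] using inv_strictAnti₀ (tiltMoment_pos 0 le_rfl (by simp)) h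
  filter_upwards [(tendsto_root_value γ).eventually_lt (tendsto_inv_tiltMoment γ) hlt,
    (tendsto_root_value γ).eventually (lt_mem_nhds (by positivity : 0 < 1 / (2 * γ))),
    eventually_ge_atTop 1] with s h1 h2 hs
  exact lt_optSlack_of_lt_inv hs hγ h2 rfl h1

theorem eventually_optSlack_lt {γ : ℝ} (hγ : 0 < γ)
    (h : 2 * γ < tiltMoment 0 0 (γ - 1 / (2 * γ))) : ∀ᶠ s in atTop, optSlack s < γ := by
  have hlt : (tiltMoment 0 0 (γ - 1 / (2 * γ)))⁻¹ < 1 / (2 * γ) := by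
    simpa only [one_div] using inv_strictAnti₀ (by positivity : 0 < 2 * γ) h
  filter_upwards [(tendsto_inv_tiltMoment γ).eventually_lt (tendsto_root_value γ) hlt,
    (tendsto_root_value γ).eventually (lt_mem_nhds (by positivity : 0 < 1 / (2 * γ))),
    eventually_ge_atTop 1] with s h1 h2 hs
  exact optSlack_lt_of_inv_lt hs hγ h2 rfl h1

theorem exists_tendsto_optSlack {lo hi : ℝ} (hlo : ∀ᶠ s in atTop, lo < optSlack s)
    (hhi : ∀ᶠ s in atTop, optSlack s < hi) :
    ∃ l, Tendsto optSlack atTop (𝓝 l) ∧ lo ≤ l ∧ l ≤ hi := by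
  have hmono : Monotone fun n : ℕ => optSlack (n + 1) := fun m n hmn => by
    rcases hmn.eq_or_lt with rfl | hlt
    · exact le_rfl
    · exact (optSlack_lt_optSlack (by omega) (by omega)).le
  have hbdd : BddAbove (range fun n : ℕ => optSlack (n + 1)) := by
    obtain ⟨N, hN⟩ := eventually_atTop.1 hhi
    refine ⟨hi, ?_⟩
    rintro _ ⟨n, rfl⟩
    exact (hmono (le_max_left n N)).trans (hN _ (by have := le_max_right n N; omega)).le
  have ht := (tendsto_add_atTop_iff_nat 1).1 (tendsto_atTop_ciSup hmono hbdd)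
  exact ⟨_, ht, ge_of_tendsto ht (hlo.mono fun _ h => h.le),
    le_of_tendsto ht (hhi.mono fun _ h => h.le)⟩

/-! ### The values at `s = 1` and `s = 550`. -/

theorem optSlack_one : optSlack 1 = 1 / 2 := by
  have hc : carriedLoad 1 1 = 1 / 2 := by
    have := carriedLoad_succ 0 (lam := 1) one_pos
    rw [carriedLoad_zero] at this
    norm_num at this ⊢
    exact this
  have h : overloadGap 1 1 = 0 := by rw [overloadGap, hc]; norm_num
  rw [optSlack, ← (overloadGap_eq_zero_iff le_rfl one_pos).1 h, slack, hc]
  norm_num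

/-- Fixed-point lower approximation of the reciprocal of the Erlang B formula at load `p / q`. -/
def invErlangLow (N p q : ℕ) : ℕ → ℕ
  | 0 => N
  | k + 1 => N + q * (k + 1) * invErlangLow N p q k / p

/-- Fixed-point upper approximation of the reciprocal of the Erlang B formula at load `p / q`. -/
def invErlangHigh (N p q : ℕ) : ℕ → ℕ
  | 0 => N
  | k + 1 => N + q * (k + 1) * invErlangHigh N p q k / p + 1

theorem inv_erlangB_succ (s : ℕ) {lam : ℝ} (h : 0 < lam) :
    (erlangB (s + 1) lam)⁻¹ = 1 + (s + 1) / lam * (erlangB s lam)⁻¹ := by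
  have := erlangB_pos s h
  rw [erlangB_succ s h]
  field_simp
  ring

theorem invErlang_bounds (N p q : ℕ) (hp : 0 < p) (hq : 0 < q) (k : ℕ) :
    (invErlangLow N p q k : ℝ) ≤ N * (erlangB k (p / q))⁻¹ ∧
      N * (erlangB k (p / q))⁻¹ ≤ (invErlangHigh N p q k : ℝ) := by
  have hp' : (0 : ℝ) < p := by exact_mod_cast hp
  have hq' : (0 : ℝ) < q := by exact_mod_cast hq
  induction k with
  | zero => simp [invErlangLow, invErlangHigh, erlangB_zero]
  | succ k ih =>
    have e : (N : ℝ) * (erlangB (k + 1) (p / q))⁻¹ =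
        N + q * (k + 1) * (N * (erlangB k (p / q))⁻¹) / p := by
      rw [inv_erlangB_succ k (by positivity)]
      field_simp
    rw [e]
    constructor
    · rw [invErlangLow]
      have h1 : ((q * (k + 1) * invErlangLow N p q k / p : ℕ) : ℝ) ≤
          ((q * (k + 1) * invErlangLow N p q k : ℕ) : ℝ) / p := Nat.cast_div_le
      push_cast at h1 ⊢
      refine add_le_add le_rfl (h1.trans ?_)
      gcongr
      exact ih.1
    -- The final `+ 1` in the recursion compensates for the rounding down of the quotient.
    · rw [invErlangHigh]
      have h1 : ((q * (k + 1) * invErlangHigh N p q k : ℕ) : ℝ) / p <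
          ((q * (k + 1) * invErlangHigh N p q k / p : ℕ) : ℝ) + 1 := by
        rw [div_lt_iff₀ hp']
        exact_mod_cast Nat.lt_mul_of_div_lt (Nat.lt_succ_self _) hp
      push_cast at h1 ⊢
      rw [add_assoc]
      refine add_le_add le_rfl (le_trans ?_ h1.le)
      gcongr
      exact ih.2

theorem erlangB_mem_Icc {N p q L H k : ℕ} (hp : 0 < p) (hq : 0 < q) (hN : 0 < N) (hL : 0 < L)
    (h₁ : L ≤ invErlangLow N p q k) (h₂ : invErlangHigh N p q k ≤ H) :
    (N : ℝ) / H ≤ erlangB k (p / q) ∧ erlangB k (p / q) ≤ (N : ℝ) / L := by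
  obtain ⟨b₁, b₂⟩ := invErlang_bounds N p q hp hq k
  have hB := erlangB_pos k (lam := (p : ℝ) / q)
    (div_pos (by exact_mod_cast hp) (by exact_mod_cast hq))
  have hN' : (0 : ℝ) < N := by exact_mod_cast hN
  have hL' : (0 : ℝ) < L := by exact_mod_cast hL
  have c₁ : (L : ℝ) ≤ N * (erlangB k (p / q))⁻¹ := le_trans (by exact_mod_cast h₁) b₁
  have c₂ : N * (erlangB k (p / q))⁻¹ ≤ (H : ℝ) := le_trans b₂ (by exact_mod_cast h₂)
  have hH' : (0 : ℝ) < H := hL'.trans_le (c₁.trans c₂)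
  rw [← div_eq_mul_inv, le_div_iff₀ hB] at c₁
  rw [← div_eq_mul_inv, div_le_iff₀ hB] at c₂
  exact ⟨by rw [div_le_iff₀ hH']; linarith, by rw [le_div_iff₀ hL']; linarith⟩

/-- The optimal load for `s = 550` lies between `537.8` and `537.808`; the recursion, scaled by
`10^15`, certifies the sign of the overload gap at these loads. -/
theorem optSlack_550_lt : optSlack 550 < 1 + 1 / 1000 := by
  have h₁ : 47873 * 10 ^ 12 ≤ invErlangLow (10 ^ 15) 5378 10 550 := by decide +kernel
  have hB := (erlangB_mem_Icc (by norm_num) (by norm_num) (by norm_num) (by norm_num) h₁ le_rfl).2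
  have hB0 := erlangB_pos 550 (lam := ((5378 : ℕ) : ℝ) / (10 : ℕ)) (by norm_num)
  norm_num at hB hB0
  clear h₁
  have hc : carriedLoad 550 (2689 / 5) = 2689 / 5 * (1 - erlangB 550 (2689 / 5)) := rfl
  generalize erlangB 550 (2689 / 5) = B at *
  have hgap : overloadGap 550 (2689 / 5) < 0 := by
    rw [overloadGap, hc, Nat.cast_ofNat]
    clear hc
    nlinarith
  have hlt := strictAntiOn_slack (s := 550) (by norm_num) (mem_Ioi.2 (by norm_num))
    (mem_Ioi.2 (optLoad_spec (by norm_num)).1) ((lt_optLoad_iff (by norm_num) (by norm_num)).2 hgap)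
  refine lt_trans hlt ?_
  rw [slack, hc, div_lt_iff₀ (Real.sqrt_pos.2 (Nat.cast_pos.2 (by norm_num)))]
  have : (23.452 : ℝ) ≤ √((550 : ℕ) : ℝ) := by
    rw [Real.le_sqrt' (by norm_num)]
    norm_num
  rw [Nat.cast_ofNat] at this ⊢
  clear hlt hgap hc
  nlinarith

theorem lt_optSlack_550 : 1 - 1 / 1000 < optSlack 550 := by
  have h₂ : invErlangHigh (10 ^ 15) 537808 1000 550 ≤ 47857 * 10 ^ 12 := by decide +kernel
  -- Only the lower bound for `B` is needed; this crude bound supplies positivity.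
  have h₁ : 47 * 10 ^ 15 ≤ invErlangLow (10 ^ 15) 537808 1000 550 := by decide +kernel
  have hB := (erlangB_mem_Icc (by norm_num) (by norm_num) (by norm_num) (by norm_num) h₁ h₂).1
  norm_num at hB
  clear h₁ h₂
  have hc : carriedLoad 550 (67226 / 125) = 67226 / 125 * (1 - erlangB 550 (67226 / 125)) := rfl
  generalize erlangB 550 (67226 / 125) = B at *
  have hgap : 0 < overloadGap 550 (67226 / 125) := by
    rw [overloadGap, hc, Nat.cast_ofNat]
    clear hc
    nlinarith
  have hlt := strictAntiOn_slack (s := 550) (by norm_num)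
    (mem_Ioi.2 (optLoad_spec (by norm_num)).1) (mem_Ioi.2 (by norm_num))
    ((optLoad_lt_iff (by norm_num) (by norm_num)).2 hgap)
  refine lt_trans ?_ hlt
  rw [slack, hc, lt_div_iff₀ (Real.sqrt_pos.2 (Nat.cast_pos.2 (by norm_num)))]
  have : √((550 : ℕ) : ℝ) ≤ 23.4521 := by
    rw [Real.sqrt_le_left (by norm_num)]
    norm_num
  rw [Nat.cast_ofNat] at this ⊢
  clear hlt hgap hc
  nlinarith

/-! ### Numerical enclosure of the limit. -/

/-- The Taylor polynomial of `exp (x²/2) ∫₀ˣ exp (-t²/2) dt` of degree 15. -/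
noncomputable def dawsonPoly (x : ℝ) : ℝ :=
  x + x ^ 3 / 3 + x ^ 5 / 15 + x ^ 7 / 105 + x ^ 9 / 945 + x ^ 11 / 10395 + x ^ 13 / 135135 +
    x ^ 15 / 2027025

theorem hasDerivAt_dawsonPoly (x : ℝ) :
    HasDerivAt dawsonPoly (1 + x * dawsonPoly x - x ^ 16 / 2027025) x := by
  have h := fun n : ℕ => hasDerivAt_pow n x
  have := ((((((((hasDerivAt_id x).add ((h 3).div_const 3)).add ((h 5).div_const 15)).add
    ((h 7).div_const 105)).add ((h 9).div_const 945)).add ((h 11).div_const 10395)).add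
    ((h 13).div_const 135135)).add ((h 15).div_const 2027025))
  refine this.congr_deriv ?_
  rw [dawsonPoly]
  norm_num
  ring

theorem hasDerivAt_exp_neg_sq_half (x : ℝ) :
    HasDerivAt (fun x : ℝ => Real.exp (-(x ^ 2) / 2)) (Real.exp (-(x ^ 2) / 2) * -x) x := by
  have := (((hasDerivAt_pow 2 x).neg).div_const 2).exp
  refine this.congr_deriv ?_
  simp only [Pi.neg_apply, Nat.cast_ofNat]
  ring

/-- The primitive of `exp (-t²/2)` that vanishes at `0`. -/
noncomputable def gaussPrimitive (x : ℝ) : ℝ := ∫ t in (0 : ℝ)..x, Real.exp (-(t ^ 2) / 2)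

theorem hasDerivAt_gaussPrimitive (x : ℝ) :
    HasDerivAt gaussPrimitive (Real.exp (-(x ^ 2) / 2)) x := by
  have hc : Continuous fun t : ℝ => Real.exp (-(t ^ 2) / 2) := by fun_prop
  exact intervalIntegral.integral_hasDerivAt_right (hc.intervalIntegrable 0 x)
    (hc.stronglyMeasurableAtFilter _ _) hc.continuousAt

theorem gaussPrimitive_neg (x : ℝ) : gaussPrimitive (-x) = -gaussPrimitive x := by
  unfold gaussPrimitive
  have := intervalIntegral.integral_comp_neg (a := 0) (b := x)
    (fun t : ℝ => Real.exp (-(t ^ 2) / 2))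
  simp only [neg_sq, neg_zero] at this
  rw [this, intervalIntegral.integral_symm]

/-- The derivative of `exp(-x²/2) dawsonPoly x` is `exp(-x²/2)(1 - x^16/15!!)`, so the error lies
between `0` and the integral of `x^16/15!!`, which is `x^17/17!!`. -/
theorem gaussPrimitive_bounds {x : ℝ} (hx : 0 ≤ x) :
    Real.exp (-(x ^ 2) / 2) * dawsonPoly x ≤ gaussPrimitive x ∧
      gaussPrimitive x ≤ Real.exp (-(x ^ 2) / 2) * dawsonPoly x + x ^ 17 / 34459425 := by
  have hd := fun y => (hasDerivAt_exp_neg_sq_half y).mul (hasDerivAt_dawsonPoly y)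
  constructor
  · have := le_of_hasDerivAt_nonneg (a := 0) (fun y _ => (hasDerivAt_gaussPrimitive y).sub (hd y))
      (fun y hy => by
        have e : Real.exp (-(y ^ 2) / 2) - (Real.exp (-(y ^ 2) / 2) * -y * dawsonPoly y +
          Real.exp (-(y ^ 2) / 2) * (1 + y * dawsonPoly y - y ^ 16 / 2027025)) =
          Real.exp (-(y ^ 2) / 2) * (y ^ 16 / 2027025) := by ring
        rw [e]
        positivity) hx
    simp [gaussPrimitive, dawsonPoly] at this
    rw [gaussPrimitive, dawsonPoly]
    linarith
  · have := le_of_hasDerivAt_nonneg (a := 0) (fun y _ =>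
      ((hd y).add ((hasDerivAt_pow 17 y).div_const 34459425)).sub (hasDerivAt_gaussPrimitive y))
      (fun y hy => by
        have e : Real.exp (-(y ^ 2) / 2) * -y * dawsonPoly y +
          Real.exp (-(y ^ 2) / 2) * (1 + y * dawsonPoly y - y ^ 16 / 2027025) +
          ((17 : ℕ) : ℝ) * y ^ (17 - 1) / 34459425 - Real.exp (-(y ^ 2) / 2) =
          (1 - Real.exp (-(y ^ 2) / 2)) * (y ^ 16 / 2027025) := by
            norm_num
            ring
        rw [e]
        have : Real.exp (-(y ^ 2) / 2) ≤ 1 := Real.exp_le_one_iff.2 (by nlinarith)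
        have := sub_nonneg.2 this
        positivity) hx
    simp [gaussPrimitive, dawsonPoly] at this
    rw [gaussPrimitive, dawsonPoly]
    linarith

/-- At `ε = 0` the exponent is `δy - y²/2`; completing the square leaves a Gaussian tail. -/
theorem tiltMoment_zero_zero (δ : ℝ) :
    tiltMoment 0 0 δ = Real.exp (δ ^ 2 / 2) * (√(Real.pi / 2) + gaussPrimitive δ) := by
  have hint : MeasureTheory.IntegrableOn (fun t : ℝ => Real.exp (-(t ^ 2) / 2)) (Ioi 0) := by
    have := (integrable_exp_neg_mul_sq (b := 1 / 2) (by norm_num)).integrableOn (s := Ioi 0)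
    refine this.congr_fun (fun t _ => ?_) measurableSet_Ioi
    simp only
    congr 1
    ring
  have hval : ∫ t in Ioi (0 : ℝ), Real.exp (-(t ^ 2) / 2) = √(Real.pi / 2) := by
    have := integral_gaussian_Ioi (1 / 2)
    have e : (fun t : ℝ => Real.exp (-(1 / 2) * t ^ 2)) = fun t => Real.exp (-(t ^ 2) / 2) := by
      funext t; congr 1; ring
    rw [e] at this
    rw [this, show Real.pi / (1 / 2) = 2 ^ 2 * (Real.pi / 2) by ring,
      Real.sqrt_mul (by norm_num), Real.sqrt_sq (by norm_num)]
    ring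
  have hlim : Tendsto gaussPrimitive atTop (𝓝 √(Real.pi / 2)) := by
    rw [← hval]
    exact MeasureTheory.intervalIntegral_tendsto_integral_Ioi 0 hint tendsto_id
  have hw : ∀ y, y ^ 0 * tiltWeight 0 δ y =
      Real.exp (δ ^ 2 / 2) * Real.exp (-((y - δ) ^ 2) / 2) := by
    intro y
    have : tiltExponent 0 y = y ^ 2 / 2 := by simp [tiltExponent]
    rw [pow_zero, one_mul, tiltWeight, this, ← Real.exp_add]
    congr 1
    ring
  have key := MeasureTheory.integral_Ioi_of_hasDerivAt_of_tendsto' (a := 0)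
    (f := fun y => Real.exp (δ ^ 2 / 2) * gaussPrimitive (y - δ))
    (f' := fun y => y ^ 0 * tiltWeight 0 δ y)
    (fun y _ => by
      have := ((hasDerivAt_gaussPrimitive (y - δ)).comp y
        ((hasDerivAt_id y).sub_const δ)).const_mul (Real.exp (δ ^ 2 / 2))
      rw [mul_one] at this
      rw [hw]
      exact this)
    (integrableOn_tiltWeight 0 le_rfl (by simp))
    ((hlim.comp (tendsto_atTop_add_const_right _ (-δ) tendsto_id)).const_mul _)
  rw [tiltMoment, key, zero_sub, gaussPrimitive_neg]
  ring

theorem tiltMoment_zero_zero_bounds {δ : ℝ} (hδ : 0 ≤ δ) :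
    Real.exp (δ ^ 2 / 2) * √(Real.pi / 2) + dawsonPoly δ ≤ tiltMoment 0 0 δ ∧
      tiltMoment 0 0 δ ≤
        Real.exp (δ ^ 2 / 2) * (√(Real.pi / 2) + δ ^ 17 / 34459425) + dawsonPoly δ := by
  obtain ⟨h₁, h₂⟩ := gaussPrimitive_bounds hδ
  have e : Real.exp (δ ^ 2 / 2) * (Real.exp (-(δ ^ 2) / 2) * dawsonPoly δ) = dawsonPoly δ := by
    rw [← mul_assoc, ← Real.exp_add]
    ring_nf
    simp
  have hE := Real.exp_pos (δ ^ 2 / 2)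
  rw [tiltMoment_zero_zero]
  constructor
  · have := mul_le_mul_of_nonneg_left h₁ hE.le
    rw [e] at this
    linarith
  · have := mul_le_mul_of_nonneg_left h₂ hE.le
    rw [mul_add, e] at this
    linarith

/-- The test points here and in `tiltMoment_at_upper` lie strictly inside the stated interval, so
the weak inequalities that survive the limit still give strict bounds. -/
theorem tiltMoment_at_lower : tiltMoment 0 0 (1.03411345952 - 1 / (2 * 1.03411345952)) <
    2 * 1.03411345952 := by
  obtain ⟨δ, hδ⟩ : ∃ δ : ℝ, δ = 1.03411345952 - 1 / (2 * 1.03411345952) := ⟨_, rfl⟩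
  have hδ0 : 0 ≤ δ := by rw [hδ]; norm_num
  have hδ1 : δ ≤ 0.55060751982159 := by rw [hδ]; norm_num
  have hx : δ ^ 2 / 2 ≤ 0.15158432044205 := by nlinarith
  have hexp : Real.exp (δ ^ 2 / 2) ≤ 1.1636764193831 := by
    refine (Real.exp_le_exp.2 hx).trans ((Real.exp_bound' (by norm_num) (by norm_num)
      (by norm_num : 0 < 10)).trans ?_)
    norm_num [Finset.sum_range_succ, Nat.factorial]
  have hpi : √(Real.pi / 2) ≤ 1.2533141373156 := by
    rw [Real.sqrt_le_left (by norm_num)]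
    have := Real.pi_lt_d20
    norm_num at this ⊢
    linarith
  have hr : δ ^ 17 / 34459425 ≤ 0.000000000002 := by
    have : δ ^ 17 ≤ 0.55060751982159 ^ 17 := by gcongr
    norm_num at this ⊢
    linarith
  have hP : dawsonPoly δ ≤ 0.6097748113452 := by
    have : dawsonPoly δ ≤ dawsonPoly 0.55060751982159 := by
      unfold dawsonPoly
      gcongr
    refine this.trans ?_
    norm_num [dawsonPoly]
  rw [← hδ]
  have h1 : Real.exp (δ ^ 2 / 2) * (√(Real.pi / 2) + δ ^ 17 / 34459425) ≤
      1.1636764193831 * (1.2533141373156 + 0.000000000002) := by gcongr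
  have h2 := (tiltMoment_zero_zero_bounds hδ0).2
  norm_num at h1 h2 hP ⊢
  linarith

theorem tiltMoment_at_upper : 2 * 1.03411345956 <
    tiltMoment 0 0 (1.03411345956 - 1 / (2 * 1.03411345956)) := by
  obtain ⟨δ, hδ⟩ : ∃ δ : ℝ, δ = 1.03411345956 - 1 / (2 * 1.03411345956) := ⟨_, rfl⟩
  have hδ1 : 0.55060751988028 ≤ δ := by rw [hδ]; norm_num
  have hδ0 : 0 ≤ δ := le_trans (by norm_num) hδ1
  have hx : 0.15158432047435 ≤ δ ^ 2 / 2 := by nlinarith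
  have hexp : 1.16367641942062 ≤ Real.exp (δ ^ 2 / 2) := by
    refine le_trans ?_ ((Real.sum_le_exp_of_nonneg (by norm_num) 10).trans (Real.exp_le_exp.2 hx))
    norm_num [Finset.sum_range_succ, Nat.factorial]
  have hpi : 1.2533141373155 ≤ √(Real.pi / 2) := by
    rw [Real.le_sqrt' (by norm_num)]
    have := Real.pi_gt_d20
    norm_num at this ⊢
    linarith
  have hP : 0.6097748114234 ≤ dawsonPoly δ := by
    have : dawsonPoly 0.55060751988028 ≤ dawsonPoly δ := by
      unfold dawsonPoly
      gcongr
    refine le_trans ?_ this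
    norm_num [dawsonPoly]
  rw [← hδ]
  have h1 : 1.16367641942062 * 1.2533141373155 ≤ Real.exp (δ ^ 2 / 2) * √(Real.pi / 2) := by gcongr
  have h2 := (tiltMoment_zero_zero_bounds hδ0).1
  norm_num at h1 h2 hP ⊢
  linarith

theorem mainTheorem7 :
    -- Cohen's equation has exactly one solution, so that `cohenSol s γ` is that solution
    (∀ s : ℕ, 1 ≤ s → ∀ γ ∈ Ioo (0 : ℝ) √s, ∃! a : ℝ, IsCohenSolution s γ a) ∧
    -- range of `L_s`
    (∀ s : ℕ, 1 ≤ s → ∀ γ ∈ Ioo (0 : ℝ) √s, carriedL s γ ∈ Ioo 0 (√s - γ)) ∧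
    -- asymptotics as `γ ↓ 0` and as `γ ↑ √s`, with constants that do not depend on `s`
    (∃ C : ℝ, ∀ s : ℕ, 1 ≤ s → ∀ᶠ γ in 𝓝[>] (0 : ℝ),
      |carriedL s γ - γ * s| ≤ γ * s * (C * (γ * √s))) ∧
    (∃ C : ℝ, ∀ s : ℕ, 1 ≤ s → ∀ᶠ γ in 𝓝[<] √(s : ℝ),
      |carriedL s γ - (√s - γ)| ≤
        (√s - γ) * (C * (Real.exp s / √s * (1 - γ / √s) ^ s))) ∧
    ∃ γhat : ℕ → ℝ,
      (∀ s : ℕ, 1 ≤ s →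
        -- `γhat s` is the unique root
        γhat s ∈ Ioo (0 : ℝ) √s ∧
        (∀ γ ∈ Ioo (0 : ℝ) √s, γ * cohenSol s γ = 1 / 2 * (1 - γ / √s) ↔ γ = γhat s) ∧
        -- unimodality, with the maximum at `γhat s`, and the maximum value
        StrictMonoOn (carriedL s) (Ioc 0 (γhat s)) ∧
        StrictAntiOn (carriedL s) (Ico (γhat s) √s) ∧
        (∀ γ ∈ Ioo (0 : ℝ) √s, γ ≠ γhat s → carriedL s γ < carriedL s (γhat s)) ∧
        carriedL s (γhat s) = γhat s / (γhat s + 1 / (2 * √s)) * (√s - γhat s)) ∧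
      -- lower bounds
      (∀ s : ℕ, 2 ≤ s →
        lossF s 0 < γhat s ∧
        √(1 / 2 + 1 / (16 * (s : ℝ))) - 1 / (4 * √s) < lossF s 0) ∧
      -- monotonicity in `s` and the values at `s = 1`, `s = 550` and `s = ∞`
      StrictMonoOn γhat (Ici 1) ∧
      γhat 1 = 1 / 2 ∧
      |γhat 550 - 1| < 1 / 1000 ∧
      ∃ l : ℝ, Tendsto γhat atTop (𝓝 l) ∧ 1.0341134595 < l ∧ l < 1.0341134596 := by
  obtain ⟨l, hl, hlo, hhi⟩ := exists_tendsto_optSlack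
    (eventually_lt_optSlack (by norm_num) tiltMoment_at_lower)
    (eventually_optSlack_lt (by norm_num) tiltMoment_at_upper)
  refine ⟨fun s hs γ hγ => existsUnique_isCohenSolution hs hγ,
    fun s hs γ hγ => carriedL_mem_Ioo hs hγ, ⟨2, fun s hs => ?_⟩,
    ⟨2, fun s hs => eventually_abs_carriedL_sub_le hs⟩, optSlack,
    fun s hs => ⟨optSlack_mem hs, fun γ hγ => root_iff_optSlack hs hγ, carriedL_strictMonoOn hs,
      carriedL_strictAntiOn hs, fun γ hγ hne => carriedL_lt_optSlack hs hγ hne,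
      carriedL_optSlack hs⟩,
    fun s hs => ⟨lossF_zero_lt_optSlack hs, lt_lossF_zero hs⟩,
    fun s hs t _ hst => optSlack_lt_optSlack hs hst, optSlack_one, ?_, l, hl, ?_, ?_⟩
  · have hs0 : (0 : ℝ) < s := by exact_mod_cast hs
    filter_upwards [Ioo_mem_nhdsGT (Real.sqrt_pos.2 hs0)] with γ hγ
    exact abs_carriedL_sub_le hs hγ
  · rw [abs_lt]
    constructor <;> linarith [optSlack_550_lt, lt_optSlack_550]
  · exact lt_of_lt_of_le (by norm_num) hlo
  · exact lt_of_le_of_lt hhi (by norm_num)
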